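/- Let $n\ge 1$, $s\in(0,1)$, $\delta>0$, $p\in[1,\infty]$, and let $\Omega\subset\mathbb{R}^n$ be a bounded Lipschitz domain (open, connected, non-empty and bounded, and near each boundary point, in suitable Cartesian coordinates, the region strictly above the graph of a Lipschitz function). Put $\Omega_\delta=\{x\in\mathbb{R}^n:\operatorname{dist}(x,\Omega)<\delta\}$. Let $w_\delta\in C_c^\infty(B_\delta(0))$ be non-negative, radial, radially decreasing ($w_\delta(z)\ge w_\delta(\tilde z)$ if $|z|\le|\tilde z|$), and equal to $1$ on $B_{\mu\delta}(0)$ for some $\mu\in(0,1)$. Put $$\rho_\delta^s(z)=c_{n,s,\delta}\,\frac{w_\delta(z)}{|z|^{n+s-1}},\qquad c_{n,s,\delta}\int_{B_\delta(0)}\frac{w_\delta(z)}{|z|^{n+s-1}}\,dz=n,$$ and for $\psi\in C_c^\infty(\mathbb{R}^n;\mathbb{R}^n)$ $$\operatorname{div}_\delta^s\psi(x)=\int_{\mathbb{R}^n}\frac{\psi(x)-\psi(y)}{|x-y|}\cdot\frac{x-y}{|x-y|}\,\rho_\delta^s(x-y)\,dy .$$ A function $v\in L^1_{\rm loc}(\Omega;\mathbb{R}^n)$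 is the weak nonlocal gradient $D_\delta^s u$ of $u\in L^1_{\rm loc}(\Omega_\delta)$ if $$\int_\Omega v\cdot\psi\,dx=-\int_{\Omega_\delta}u\,\operatorname{div}_\delta^s\psi\,dx\qquad\text{for all }\psi\in C_c^\infty(\Omega;\mathbb{R}^n).$$ Let $H^{s,p,\delta}(\Omega)=\{u\in L^p(\Omega_\delta): D_\delta^su\in L^p(\Omega;\mathbb{R}^n)\}$ with norm $\big(\|u\|_{L^p(\Omega_\delta)}^p+\|D_\delta^su\|_{L^p(\Omega;\mathbb{R}^n)}^p\big)^{1/p}$ (the maximum of the two norms if $p=\infty$), and let $$N^{s,p,\delta}(\Omega)=\{h\in H^{s,p,\delta}(\Omega): D_\delta^sh=0\ \text{a.e. in }\Omega\}.$$ Then $N^{s,p,\delta}(\Omega)$ is an infinite-dimensional closed subspace of $H^{s,p,\delta}(\Omega)$. -/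

import Mathlib

open scoped ContDiff ENNReal

noncomputable section

namespace NonlocalSobolev

open MeasureTheory Set Metric

/-- A cut-off function `w` on `ℝⁿ` with horizon `δ`: non-negative, radial, smooth, compactly
supported in the open ball `B_δ(0)`, equal to one near the origin, and radially decreasing. -/
structure CutOff (n : ℕ) (δ : ℝ) where
  /-- the underlying function -/
  toFun : EuclideanSpace ℝ (Fin n) → ℝ
  nonneg : ∀ z, 0 ≤ toFun z
  radial : ∃ wbar : ℝ → ℝ, (∀ r, 0 ≤ wbar r) ∧ ∀ z, toFun z = wbar ‖z‖
  smooth : ContDiff ℝ ∞ toFun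
  hasCompactSupport : HasCompactSupport toFun
  tsupport_subset : tsupport toFun ⊆ ball 0 δ
  eq_one : ∃ μ ∈ Ioo (0 : ℝ) 1, ∀ z ∈ ball (0 : EuclideanSpace ℝ (Fin n)) (μ * δ), toFun z = 1
  decreasing : ∀ z z', ‖z‖ ≤ ‖z'‖ → toFun z' ≤ toFun z

variable {n : ℕ} {δ : ℝ}

/-- The constant `c_{n,s,δ}`, determined by
`c_{n,s,δ} * ∫_{B_δ(0)} w(z) / |z|^(n+s-1) dz = n`. -/
def scalingConstant (s : ℝ) (w : CutOff n δ) : ℝ :=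
  (n : ℝ) / ∫ z in ball (0 : EuclideanSpace ℝ (Fin n)) δ, w.toFun z / ‖z‖ ^ ((n : ℝ) + s - 1)

/-- The kernel `ρ(z) = c_{n,s,δ} * w(z) / |z|^(n+s-1)`. -/
def kernel (s : ℝ) (w : CutOff n δ) (z : EuclideanSpace ℝ (Fin n)) : ℝ :=
  scalingConstant s w * (w.toFun z / ‖z‖ ^ ((n : ℝ) + s - 1))

/-- The nonlocal divergence
`div ψ(x) = ∫ (ψ(x) - ψ(y)) / |x - y| · (x - y) / |x - y| * ρ(x - y) dy`. -/
def nonlocalDiv (s : ℝ) (w : CutOff n δ)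
    (ψ : EuclideanSpace ℝ (Fin n) → EuclideanSpace ℝ (Fin n))
    (x : EuclideanSpace ℝ (Fin n)) : ℝ :=
  ∫ y, inner ℝ (‖x - y‖⁻¹ • (ψ x - ψ y)) (‖x - y‖⁻¹ • (x - y)) * kernel s w (x - y)

/-- The enlarged set `Ω_δ = {x | dist(x, Ω) < δ}`. -/
abbrev enlarged (δ : ℝ) (Ω : TopologicalSpace.Opens (EuclideanSpace ℝ (Fin n))) :
    Set (EuclideanSpace ℝ (Fin n)) :=
  thickening δ (Ω : Set (EuclideanSpace ℝ (Fin n)))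

/-- `v ∈ L¹_loc(Ω; ℝⁿ)` is a weak nonlocal gradient of `u ∈ L¹_loc(Ω_δ)`:
`∫_Ω v · ψ = - ∫_{Ω_δ} u div ψ` for all `ψ ∈ C_c^∞(Ω; ℝⁿ)`. -/
def IsWeakNonlocalGradient (s : ℝ) (w : CutOff n δ)
    (Ω : TopologicalSpace.Opens (EuclideanSpace ℝ (Fin n)))
    (u : EuclideanSpace ℝ (Fin n) → ℝ)
    (v : EuclideanSpace ℝ (Fin n) → EuclideanSpace ℝ (Fin n)) : Prop :=
  LocallyIntegrableOn u (enlarged δ Ω) ∧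
  LocallyIntegrableOn v (Ω : Set (EuclideanSpace ℝ (Fin n))) ∧
  ∀ ψ : EuclideanSpace ℝ (Fin n) → EuclideanSpace ℝ (Fin n),
    ContDiff ℝ ∞ ψ → HasCompactSupport ψ → tsupport ψ ⊆ Ω →
      ∫ x in (Ω : Set (EuclideanSpace ℝ (Fin n))), inner ℝ (v x) (ψ x) =
        - ∫ x in enlarged δ Ω, u x * nonlocalDiv s w ψ x

/-! ### Integrability of the terms in the definition of the weak gradient -/

theorem kernel_integrable {s : ℝ} (hs : s ∈ Ioo (0 : ℝ) 1) (w : CutOff n δ) :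
    Integrable (kernel s w) := by
  rcases Nat.eq_zero_or_pos n with rfl | hn
  · exact Integrable.of_finite
  refine Integrable.const_mul ?_ _
  have hc : Continuous w.toFun := w.smooth.continuous
  have hm : Measurable fun z : EuclideanSpace ℝ (Fin n) =>
      w.toFun z / ‖z‖ ^ ((n : ℝ) + s - 1) :=
    hc.measurable.div (measurable_norm.pow_const _)
  obtain ⟨C, hC⟩ := w.hasCompactSupport.exists_bound_of_continuous hc
  rw [← integrableOn_iff_integrable_of_support_subset (s := ball 0 δ)]
  · refine integrableOn_ball_of_norm_le_rpow (C := C) (α := (n : ℝ) + s - 1) ?_ ?_ ?_ ?_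
    · simpa using Nat.succ_le_of_lt hn
    · simp only [finrank_euclideanSpace, Fintype.card_fin]; linarith [hs.2]
    · refine ae_of_all _ fun z => ?_
      rw [norm_div, Real.rpow_neg (norm_nonneg _), div_eq_mul_inv,
        Real.norm_of_nonneg (Real.rpow_nonneg (norm_nonneg z) _)]
      exact mul_le_mul_of_nonneg_right (hC z)
        (inv_nonneg.2 (Real.rpow_nonneg (norm_nonneg z) _))
    · exact hm.aestronglyMeasurable
  · intro z hz
    refine w.tsupport_subset (subset_tsupport _ ?_)
    intro h
    exact hz (by simp [h])

theorem kernel_eq_zero {s : ℝ} (w : CutOff n δ) {z : EuclideanSpace ℝ (Fin n)}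
    (hz : δ ≤ ‖z‖) : kernel s w z = 0 := by
  have : w.toFun z = 0 := by
    by_contra h
    have := w.tsupport_subset (subset_tsupport _ h)
    rw [mem_ball_zero_iff] at this
    linarith
  simp [kernel, this]

theorem nonlocalDiv_integrand_bound {s : ℝ} (w : CutOff n δ)
    {ψ : EuclideanSpace ℝ (Fin n) → EuclideanSpace ℝ (Fin n)} {L : NNReal}
    (hL : LipschitzWith L ψ) (x y : EuclideanSpace ℝ (Fin n)) :
    ‖inner ℝ (‖x - y‖⁻¹ • (ψ x - ψ y)) (‖x - y‖⁻¹ • (x - y)) * kernel s w (x - y)‖ ≤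
      L * ‖kernel s w (x - y)‖ := by
  rw [norm_mul]
  refine mul_le_mul_of_nonneg_right ?_ (norm_nonneg _)
  refine (norm_inner_le_norm _ _).trans ?_
  rcases eq_or_ne x y with rfl | hxy
  · simp
  have h0 : 0 < ‖x - y‖ := norm_pos_iff.2 (sub_ne_zero.2 hxy)
  rw [norm_smul, norm_smul, norm_inv, norm_norm, inv_mul_cancel₀ h0.ne', mul_one,
    inv_mul_le_iff₀ h0, mul_comm]
  exact hL.norm_sub_le x y

theorem nonlocalDiv_integrand_integrable {s : ℝ} (hs : s ∈ Ioo (0 : ℝ) 1) (w : CutOff n δ)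
    {ψ : EuclideanSpace ℝ (Fin n) → EuclideanSpace ℝ (Fin n)} {L : NNReal}
    (hL : LipschitzWith L ψ) (x : EuclideanSpace ℝ (Fin n)) :
    Integrable fun y =>
      inner ℝ (‖x - y‖⁻¹ • (ψ x - ψ y)) (‖x - y‖⁻¹ • (x - y)) * kernel s w (x - y) := by
  have hk : Integrable fun y => kernel s w (x - y) := (kernel_integrable hs w).comp_sub_left x
  refine Integrable.mono' (hk.norm.const_mul (L : ℝ)) ?_
    (ae_of_all _ fun y => nonlocalDiv_integrand_bound w hL x y)
  have h1 : Measurable fun y => ψ x - ψ y := measurable_const.sub hL.continuous.measurable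
  have h2 : Measurable fun y : EuclideanSpace ℝ (Fin n) => x - y := by fun_prop
  exact ((h2.norm.inv.smul h1).inner (h2.norm.inv.smul h2)).aestronglyMeasurable.mul
    hk.aestronglyMeasurable

theorem nonlocalDiv_norm_le {s : ℝ} (hs : s ∈ Ioo (0 : ℝ) 1) (w : CutOff n δ)
    {ψ : EuclideanSpace ℝ (Fin n) → EuclideanSpace ℝ (Fin n)} {L : NNReal}
    (hL : LipschitzWith L ψ) (x : EuclideanSpace ℝ (Fin n)) :
    ‖nonlocalDiv s w ψ x‖ ≤ L * ∫ z, ‖kernel s w z‖ := by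
  have hk : Integrable fun y => kernel s w (x - y) := (kernel_integrable hs w).comp_sub_left x
  refine (norm_integral_le_of_norm_le (hk.norm.const_mul (L : ℝ))
    (ae_of_all _ fun y => nonlocalDiv_integrand_bound w hL x y)).trans ?_
  rw [integral_const_mul, integral_sub_left_eq_self (fun z => ‖kernel s w z‖)]

theorem nonlocalDiv_measurable {s : ℝ} (w : CutOff n δ)
    {ψ : EuclideanSpace ℝ (Fin n) → EuclideanSpace ℝ (Fin n)} (hψ : Continuous ψ) :
    StronglyMeasurable (nonlocalDiv s w ψ) := by
  have hk : Measurable (kernel s w) :=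
    (w.smooth.continuous.measurable.div (measurable_norm.pow_const _)).const_mul _
  refine StronglyMeasurable.integral_prod_right
    (f := fun x y => inner ℝ (‖x - y‖⁻¹ • (ψ x - ψ y)) (‖x - y‖⁻¹ • (x - y)) *
      kernel s w (x - y)) ?_
  have h2 : Measurable fun q : EuclideanSpace ℝ (Fin n) × EuclideanSpace ℝ (Fin n) =>
      q.1 - q.2 := by fun_prop
  have h1 : Measurable fun q : EuclideanSpace ℝ (Fin n) × EuclideanSpace ℝ (Fin n) =>
      ψ q.1 - ψ q.2 :=
    (hψ.measurable.comp measurable_fst).sub (hψ.measurable.comp measurable_snd)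
  exact (((h2.norm.inv.smul h1).inner (h2.norm.inv.smul h2)).mul
    (hk.comp h2)).stronglyMeasurable

theorem nonlocalDiv_eq_zero {s : ℝ} (w : CutOff n δ)
    {ψ : EuclideanSpace ℝ (Fin n) → EuclideanSpace ℝ (Fin n)} {R : ℝ}
    (hR : ∀ x, R ≤ ‖x‖ → ψ x = 0) {x : EuclideanSpace ℝ (Fin n)} (hx : R + |δ| ≤ ‖x‖) :
    nonlocalDiv s w ψ x = 0 := by
  refine integral_eq_zero_of_ae (ae_of_all _ fun y => ?_)
  have hx0 : ψ x = 0 := hR x (by linarith [abs_nonneg δ])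
  by_cases hy : R ≤ ‖y‖
  · simp [hx0, hR y hy]
  · have : δ ≤ ‖x - y‖ := by
      have := norm_sub_norm_le x y
      push Not at hy
      linarith [le_abs_self δ]
    simp [kernel_eq_zero w this]

theorem mul_nonlocalDiv_integrable {s : ℝ} (hs : s ∈ Ioo (0 : ℝ) 1) (w : CutOff n δ)
    {ψ : EuclideanSpace ℝ (Fin n) → EuclideanSpace ℝ (Fin n)}
    (hψ : ContDiff ℝ ∞ ψ) (hc : HasCompactSupport ψ)
    {μ : Measure (EuclideanSpace ℝ (Fin n))} {u : EuclideanSpace ℝ (Fin n) → ℝ}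
    (hu : LocallyIntegrable u μ) : Integrable (fun x => u x * nonlocalDiv s w ψ x) μ := by
  obtain ⟨L, hL⟩ := hψ.lipschitzWith_of_hasCompactSupport hc (by simp)
  obtain ⟨R, hR⟩ : ∃ R, ∀ x, R ≤ ‖x‖ → ψ x = 0 := by
    obtain ⟨R, -, hR⟩ := hc.exists_pos_le_norm
    exact ⟨R, hR⟩
  rw [← integrableOn_iff_integrable_of_support_subset (s := closedBall 0 (R + |δ|))]
  · exact (hu.integrableOn_isCompact (isCompact_closedBall _ _)).mul_bdd
      (nonlocalDiv_measurable w hψ.continuous).aestronglyMeasurable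
      (ae_of_all _ fun x => nonlocalDiv_norm_le hs w hL x)
  · intro x hx
    rw [mem_closedBall_zero_iff]
    by_contra h
    push Not at h
    exact hx (by simp [nonlocalDiv_eq_zero w hR h.le])

theorem inner_integrable {ψ : EuclideanSpace ℝ (Fin n) → EuclideanSpace ℝ (Fin n)}
    (hψ : ContDiff ℝ ∞ ψ) (hc : HasCompactSupport ψ)
    {μ : Measure (EuclideanSpace ℝ (Fin n))}
    {v : EuclideanSpace ℝ (Fin n) → EuclideanSpace ℝ (Fin n)}
    (hv : LocallyIntegrable v μ) : Integrable (fun x => inner ℝ (v x) (ψ x)) μ := by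
  obtain ⟨C, hC⟩ := hc.exists_bound_of_continuous hψ.continuous
  rw [← integrableOn_iff_integrable_of_support_subset (s := tsupport ψ)]
  · have hi : IntegrableOn v (tsupport ψ) μ := hv.integrableOn_isCompact hc
    refine Integrable.mono' (hi.norm.mul_const C)
      (hi.aestronglyMeasurable.inner hψ.continuous.aestronglyMeasurable)
      (ae_of_all _ fun x => ?_)
    exact (norm_inner_le_norm _ _).trans
      (mul_le_mul_of_nonneg_left (hC x) (norm_nonneg _))
  · intro x hx
    refine subset_tsupport _ fun h => hx ?_
    simp [h]

/-! ### The nonlocal Sobolev space -/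

/-- `L^p(Ω_δ)`. -/
abbrev LpEnlarged (p : ℝ≥0∞) (δ : ℝ) (Ω : TopologicalSpace.Opens (EuclideanSpace ℝ (Fin n))) :=
  Lp ℝ p ((volume : Measure (EuclideanSpace ℝ (Fin n))).restrict (enlarged δ Ω))

/-- `L^p(Ω; ℝⁿ)`. -/
abbrev LpVec (p : ℝ≥0∞) (Ω : TopologicalSpace.Opens (EuclideanSpace ℝ (Fin n))) :=
  Lp (EuclideanSpace ℝ (Fin n)) p
    ((volume : Measure (EuclideanSpace ℝ (Fin n))).restrict
      (Ω : Set (EuclideanSpace ℝ (Fin n))))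

variable {p : ℝ≥0∞} {Ω : TopologicalSpace.Opens (EuclideanSpace ℝ (Fin n))}

theorem locInt_enlarged [Fact (1 ≤ p)] (u : LpEnlarged p δ Ω) :
    LocallyIntegrable u (volume.restrict (enlarged δ Ω)) :=
  (Lp.memLp u).locallyIntegrable Fact.out

theorem locInt_vec [Fact (1 ≤ p)] (v : LpVec p Ω) :
    LocallyIntegrable v (volume.restrict (Ω : Set (EuclideanSpace ℝ (Fin n)))) :=
  (Lp.memLp v).locallyIntegrable Fact.out

/-- For `L^p` functions only the integration by parts formula has to be checked. -/
theorem isWeakNonlocalGradient_iff [Fact (1 ≤ p)] {s : ℝ} {w : CutOff n δ}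
    {u : LpEnlarged p δ Ω} {v : LpVec p Ω} :
    IsWeakNonlocalGradient s w Ω u v ↔
      ∀ ψ : EuclideanSpace ℝ (Fin n) → EuclideanSpace ℝ (Fin n),
        ContDiff ℝ ∞ ψ → HasCompactSupport ψ → tsupport ψ ⊆ Ω →
          ∫ x in (Ω : Set (EuclideanSpace ℝ (Fin n))), inner ℝ (v x) (ψ x) =
            - ∫ x in enlarged δ Ω, u x * nonlocalDiv s w ψ x :=
  ⟨fun h => h.2.2, fun h =>
    ⟨locallyIntegrableOn_of_locallyIntegrable_restrict (locInt_enlarged u),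
      locallyIntegrableOn_of_locallyIntegrable_restrict (locInt_vec v), h⟩⟩

theorem IsWeakNonlocalGradient.zero [Fact (1 ≤ p)] {s : ℝ} (w : CutOff n δ) :
    IsWeakNonlocalGradient s w Ω (0 : LpEnlarged p δ Ω) (0 : LpVec p Ω) := by
  rw [isWeakNonlocalGradient_iff]
  intro ψ _ _ _
  have h1 : ∫ x in (Ω : Set (EuclideanSpace ℝ (Fin n))),
      inner ℝ ((0 : LpVec p Ω) x) (ψ x) = 0 := by
    refine integral_eq_zero_of_ae ?_
    filter_upwards [Lp.coeFn_zero (EuclideanSpace ℝ (Fin n)) p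
      (volume.restrict (Ω : Set (EuclideanSpace ℝ (Fin n))))] with x hx
    rw [hx]
    exact inner_zero_left _
  have h2 : ∫ x in enlarged δ Ω, (0 : LpEnlarged p δ Ω) x * nonlocalDiv s w ψ x = 0 := by
    refine integral_eq_zero_of_ae ?_
    filter_upwards [Lp.coeFn_zero ℝ p
      ((volume : Measure (EuclideanSpace ℝ (Fin n))).restrict (enlarged δ Ω))] with x hx
    rw [hx]
    exact zero_mul _
  rw [h1, h2, neg_zero]

theorem IsWeakNonlocalGradient.add [Fact (1 ≤ p)] {s : ℝ} (hs : s ∈ Ioo (0 : ℝ) 1)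
    {w : CutOff n δ} {u u' : LpEnlarged p δ Ω} {v v' : LpVec p Ω}
    (h : IsWeakNonlocalGradient s w Ω u v) (h' : IsWeakNonlocalGradient s w Ω u' v') :
    IsWeakNonlocalGradient s w Ω (u + u' : LpEnlarged p δ Ω) (v + v' : LpVec p Ω) := by
  rw [isWeakNonlocalGradient_iff] at *
  intro ψ hψ hc hsub
  have h1 : ∫ x in (Ω : Set (EuclideanSpace ℝ (Fin n))), inner ℝ ((v + v' : LpVec p Ω) x) (ψ x) =
      (∫ x in (Ω : Set (EuclideanSpace ℝ (Fin n))), inner ℝ (v x) (ψ x)) +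
        ∫ x in (Ω : Set (EuclideanSpace ℝ (Fin n))), inner ℝ (v' x) (ψ x) := by
    rw [← integral_add (inner_integrable hψ hc (locInt_vec v))
      (inner_integrable hψ hc (locInt_vec v'))]
    refine integral_congr_ae ?_
    filter_upwards [Lp.coeFn_add v v'] with x hx
    rw [hx]
    exact inner_add_left _ _ _
  have h2 : ∫ x in enlarged δ Ω, (u + u' : LpEnlarged p δ Ω) x * nonlocalDiv s w ψ x =
      (∫ x in enlarged δ Ω, u x * nonlocalDiv s w ψ x) +
        ∫ x in enlarged δ Ω, u' x * nonlocalDiv s w ψ x := by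
    rw [← integral_add (mul_nonlocalDiv_integrable hs w hψ hc (locInt_enlarged u))
      (mul_nonlocalDiv_integrable hs w hψ hc (locInt_enlarged u'))]
    refine integral_congr_ae ?_
    filter_upwards [Lp.coeFn_add u u'] with x hx
    rw [hx]
    exact add_mul _ _ _
  rw [h1, h2, h ψ hψ hc hsub, h' ψ hψ hc hsub]
  ring

theorem IsWeakNonlocalGradient.smul [Fact (1 ≤ p)] {s : ℝ} {w : CutOff n δ}
    {u : LpEnlarged p δ Ω} {v : LpVec p Ω} (c : ℝ) (h : IsWeakNonlocalGradient s w Ω u v) :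
    IsWeakNonlocalGradient s w Ω (c • u : LpEnlarged p δ Ω) (c • v : LpVec p Ω) := by
  rw [isWeakNonlocalGradient_iff] at *
  intro ψ hψ hc hsub
  have h1 : ∫ x in (Ω : Set (EuclideanSpace ℝ (Fin n))), inner ℝ ((c • v : LpVec p Ω) x) (ψ x) =
      c * ∫ x in (Ω : Set (EuclideanSpace ℝ (Fin n))), inner ℝ (v x) (ψ x) := by
    rw [← integral_const_mul]
    refine integral_congr_ae ?_
    filter_upwards [Lp.coeFn_smul c v] with x hx
    simp [hx, real_inner_smul_left]
  have h2 : ∫ x in enlarged δ Ω, (c • u : LpEnlarged p δ Ω) x * nonlocalDiv s w ψ x =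
      c * ∫ x in enlarged δ Ω, u x * nonlocalDiv s w ψ x := by
    rw [← integral_const_mul]
    refine integral_congr_ae ?_
    filter_upwards [Lp.coeFn_smul c u] with x hx
    simp [hx, mul_assoc]
  rw [h1, h2, h ψ hψ hc hsub]
  ring

/-- The weak nonlocal gradient is unique. -/
theorem IsWeakNonlocalGradient.unique [Fact (1 ≤ p)] {s : ℝ} {w : CutOff n δ}
    {u : LpEnlarged p δ Ω} {v v' : LpVec p Ω}
    (h : IsWeakNonlocalGradient s w Ω u v) (h' : IsWeakNonlocalGradient s w Ω u v') :
    v = v' := by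
  have hloc : LocallyIntegrable (fun x => v x - v' x)
      (volume.restrict (Ω : Set (EuclideanSpace ℝ (Fin n)))) :=
    (locInt_vec v).sub (locInt_vec v')
  have hz : ∀ i : Fin n, ∀ᵐ x : EuclideanSpace ℝ (Fin n), x ∈ Ω → (v x - v' x) i = 0 := by
    intro i
    refine IsOpen.ae_eq_zero_of_integral_contDiff_smul_eq_zero Ω.isOpen ?_ ?_
    · refine locallyIntegrableOn_of_locallyIntegrable_restrict fun x => ?_
      obtain ⟨t, ht, hi⟩ := hloc x
      exact ⟨t, ht, (EuclideanSpace.proj (𝕜 := ℝ) i).integrable_comp hi⟩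
    · intro g hg hgc hgs
      set ψ : EuclideanSpace ℝ (Fin n) → EuclideanSpace ℝ (Fin n) :=
        fun x => g x • EuclideanSpace.single i (1 : ℝ) with hψdef
      have hψ : ContDiff ℝ ∞ ψ := hg.smul contDiff_const
      have hψc : HasCompactSupport ψ := hgc.smul_right
      have hψs : tsupport ψ ⊆ Ω :=
        (closure_mono (Function.support_smul_subset_left _ _)).trans hgs
      have e := (h.2.2 ψ hψ hψc hψs).trans (h'.2.2 ψ hψ hψc hψs).symm
      rw [← sub_eq_zero, ← integral_sub (inner_integrable hψ hψc (locInt_vec v))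
        (inner_integrable hψ hψc (locInt_vec v'))] at e
      rw [← setIntegral_eq_integral_of_forall_compl_eq_zero
        (s := (Ω : Set (EuclideanSpace ℝ (Fin n)))), ← e]
      · congr 1
        ext x
        simp only [hψdef, real_inner_smul_right, EuclideanSpace.inner_single_right, smul_eq_mul,
          PiLp.sub_apply]
        simp
        ring
      · intro x hx
        have : g x = 0 := by
          by_contra hne
          exact hx (hgs (subset_tsupport _ hne))
        simp [this]
  have : v =ᵐ[volume.restrict (Ω : Set (EuclideanSpace ℝ (Fin n)))] v' := by
    refine (ae_restrict_iff' Ω.isOpen.measurableSet).2 ?_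
    filter_upwards [ae_all_iff.2 hz] with x hx hxΩ
    refine sub_eq_zero.1 ?_
    ext i
    simpa using hx i hxΩ
  exact Lp.ext this

/-- The vector space of all `u ∈ L^p(Ω_δ)` with a weak nonlocal gradient in `L^p(Ω; ℝⁿ)`. -/
def sobolevSubmodule (s : Ioo (0 : ℝ) 1) (w : CutOff n δ) (p : ℝ≥0∞) [Fact (1 ≤ p)]
    (Ω : TopologicalSpace.Opens (EuclideanSpace ℝ (Fin n))) :
    Submodule ℝ (LpEnlarged p δ Ω) where
  carrier := {u | ∃ v : LpVec p Ω, IsWeakNonlocalGradient s w Ω u v}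
  zero_mem' := ⟨0, IsWeakNonlocalGradient.zero w⟩
  add_mem' := fun ⟨v, hv⟩ ⟨v', hv'⟩ => ⟨v + v', hv.add s.2 hv'⟩
  smul_mem' := fun c _ ⟨v, hv⟩ => ⟨c • v, hv.smul c⟩

/-- The nonlocal Sobolev space `H^{s,p,δ}(Ω)`. It is a separate type, so that it carries its own
norm and not the one it would inherit from `L^p(Ω_δ)`. -/
def HSpace (s : Ioo (0 : ℝ) 1) (w : CutOff n δ) (p : ℝ≥0∞) [Fact (1 ≤ p)]
    (Ω : TopologicalSpace.Opens (EuclideanSpace ℝ (Fin n))) : Type :=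
  sobolevSubmodule s w p Ω

variable (s : Ioo (0 : ℝ) 1) (w : CutOff n δ) (p : ℝ≥0∞) [Fact (1 ≤ p)]
  (Ω : TopologicalSpace.Opens (EuclideanSpace ℝ (Fin n)))

instance instAddCommGroupHSpace : AddCommGroup (HSpace s w p Ω) :=
  inferInstanceAs (AddCommGroup (sobolevSubmodule s w p Ω))

instance instModuleHSpace : Module ℝ (HSpace s w p Ω) :=
  inferInstanceAs (Module ℝ (sobolevSubmodule s w p Ω))

/-- The inclusion of `H^{s,p,δ}(Ω)` into `L^p(Ω_δ)`. -/
def HSpace.toLp : HSpace s w p Ω →ₗ[ℝ] LpEnlarged p δ Ω :=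
  (sobolevSubmodule s w p Ω).subtype

theorem HSpace.exists_gradient (u : HSpace s w p Ω) :
    ∃ v : LpVec p Ω, IsWeakNonlocalGradient s w Ω (HSpace.toLp s w p Ω u) v :=
  u.2

/-- The weak nonlocal gradient as a linear operator `H^{s,p,δ}(Ω) → L^p(Ω; ℝⁿ)`. -/
def nonlocalGrad : HSpace s w p Ω →ₗ[ℝ] LpVec p Ω where
  toFun u := (HSpace.exists_gradient s w p Ω u).choose
  map_add' u u' :=
    IsWeakNonlocalGradient.unique (HSpace.exists_gradient s w p Ω (u + u')).choose_spec
      (IsWeakNonlocalGradient.add s.2 (HSpace.exists_gradient s w p Ω u).choose_spec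
        (HSpace.exists_gradient s w p Ω u').choose_spec)
  map_smul' c u :=
    IsWeakNonlocalGradient.unique (HSpace.exists_gradient s w p Ω (c • u)).choose_spec
      (IsWeakNonlocalGradient.smul c (HSpace.exists_gradient s w p Ω u).choose_spec)

theorem nonlocalGrad_spec (u : HSpace s w p Ω) :
    IsWeakNonlocalGradient s w Ω (HSpace.toLp s w p Ω u) (nonlocalGrad s w p Ω u) :=
  (HSpace.exists_gradient s w p Ω u).choose_spec

/-- The map `u ↦ (u, D u)` into the `ℓ^p` product of `L^p(Ω_δ)` and `L^p(Ω; ℝⁿ)`. -/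
def graphMap : HSpace s w p Ω →ₗ[ℝ] WithLp p (LpEnlarged p δ Ω × LpVec p Ω) :=
  (WithLp.linearEquiv p ℝ (LpEnlarged p δ Ω × LpVec p Ω)).symm.toLinearMap ∘ₗ
    (HSpace.toLp s w p Ω).prod (nonlocalGrad s w p Ω)

theorem graphMap_injective : Function.Injective (graphMap s w p Ω) := by
  intro u u' h
  have h1 : HSpace.toLp s w p Ω u = HSpace.toLp s w p Ω u' := congrArg WithLp.fst h
  exact Subtype.ext h1

/-- `H^{s,p,δ}(Ω)` is normed by `(‖u‖^p + ‖D u‖^p)^(1/p)`, or `max ‖u‖ ‖D u‖` if `p = ∞`. -/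
instance instNormedAddCommGroupHSpace : NormedAddCommGroup (HSpace s w p Ω) :=
  NormedAddCommGroup.induced (HSpace s w p Ω) (WithLp p (LpEnlarged p δ Ω × LpVec p Ω))
    (graphMap s w p Ω) (graphMap_injective s w p Ω)

instance instNormedSpaceHSpace : NormedSpace ℝ (HSpace s w p Ω) :=
  NormedSpace.induced ℝ (HSpace s w p Ω) (WithLp p (LpEnlarged p δ Ω × LpVec p Ω))
    (graphMap s w p Ω)

theorem HSpace.norm_eq (hp : p ≠ ⊤) (u : HSpace s w p Ω) :
    ‖u‖ = (‖HSpace.toLp s w p Ω u‖ ^ p.toReal +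
      ‖nonlocalGrad s w p Ω u‖ ^ p.toReal) ^ (1 / p.toReal) :=
  WithLp.prod_norm_eq_add
    (ENNReal.toReal_pos (zero_lt_one.trans_le (Fact.out : 1 ≤ p)).ne' hp) (graphMap s w p Ω u)

theorem HSpace.norm_eq_top (u : HSpace s w ⊤ Ω) :
    ‖u‖ = max ‖HSpace.toLp s w ⊤ Ω u‖ ‖nonlocalGrad s w ⊤ Ω u‖ :=
  rfl

/-- `N^{s,p,δ}(Ω)`: the `h ∈ H^{s,p,δ}(Ω)` with `D h = 0` a.e. in `Ω`. -/
def zeroGradient : Submodule ℝ (HSpace s w p Ω) where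
  carrier := {h | ∀ᵐ x ∂(volume.restrict (Ω : Set (EuclideanSpace ℝ (Fin n)))),
    nonlocalGrad s w p Ω h x = 0}
  zero_mem' := by
    rw [mem_ofPred_eq, map_zero]
    exact Lp.coeFn_zero _ _ _
  add_mem' := by
    intro h h' hh hh'
    rw [mem_ofPred_eq, map_add]
    filter_upwards [hh, hh', Lp.coeFn_add (nonlocalGrad s w p Ω h) (nonlocalGrad s w p Ω h')]
      with x h1 h2 h3
    rw [h3, Pi.add_apply, h1, h2, add_zero]
  smul_mem' := by
    intro c h hh
    rw [mem_ofPred_eq, map_smul]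
    filter_upwards [hh, Lp.coeFn_smul c (nonlocalGrad s w p Ω h)] with x h1 h2
    simp [h2, h1]

/-- A bounded Lipschitz domain: open, non-empty, connected and bounded, and near every boundary
point it is, in suitable Cartesian coordinates with last axis `ν`, the open region strictly above
the graph of a Lipschitz function `γ` of the component `y - ⟨ν, y⟩ ν` orthogonal to `ν`. -/
structure IsBoundedLipschitzDomain (Ω : Set (EuclideanSpace ℝ (Fin n))) : Prop where
  isOpen : IsOpen Ω
  isConnected : IsConnected Ω
  isBounded : Bornology.IsBounded Ω
  lipschitz_boundary : ∀ x ∈ frontier Ω, ∃ (ν : EuclideanSpace ℝ (Fin n)) (L : NNReal)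
    (γ : EuclideanSpace ℝ (Fin n) → ℝ) (r : ℝ),
      ‖ν‖ = 1 ∧ LipschitzWith L γ ∧ 0 < r ∧
        ∀ y ∈ ball x r, y ∈ Ω ↔ γ (y - inner ℝ ν y • ν) < inner ℝ ν y

end NonlocalSobolev

end

/-! The nonlocal gradient is translation invariant, so exponentials are its eigenfunctions: formally
it sends `exp (z * x_i)` to `m(z) * exp (z * x_i)` times the `i`-th unit vector, where `m(z) = ∫
ρ(y) |y|⁻² y_i (exp (z * y_i) - 1) dy`. The other components vanish by reflection symmetry of the
radial kernel. Every complex zero of `m` therefore yields functions with zero gradient, namely the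
real and imaginary parts of the exponential, which lie in every `L^p` of a bounded set. It remains
to find infinitely many zeros.

Since the kernel is supported in a ball, `m` is entire of exponential type; it is odd, and it grows
exponentially along the positive real axis. If it had only finitely many zeros, it would be a
function of polynomial growth times `exp (a * z + b)`, a special case of Hadamard factorization. On
one of the two real half-axes the exponential factor is bounded, so `m` grows at most polynomially
there, and by oddness on the other half-axis too: a contradiction (`IsExpType.infinite_zeros`).

The weak formulation of the eigenvalue relation is `integral_coordExp_mul_nonlocalDiv`. Distinct
exponentials are linearly independent by Dedekind's theorem on characters, so the space is
infinite-dimensional. It is closed as the kernel of the gradient, which is bounded for the graph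
norm. -/

noncomputable section

namespace NonlocalSobolev

open MeasureTheory Set Metric Filter Topology

/-! ### Zeros of entire functions of exponential type -/

/-- Entire functions of at most exponential growth. -/
structure IsExpType (f : ℂ → ℂ) : Prop where
  differentiable : Differentiable ℂ f
  growth : ∃ A C : ℝ, 0 ≤ A ∧ 0 ≤ C ∧ ∀ z, ‖f z‖ ≤ C * Real.exp (A * ‖z‖)

/-- Dividing out the zero at `a` preserves exponential type: outside the unit disc about `a` the
quotient is dominated by `f`, and inside it is bounded by compactness. -/
theorem IsExpType.exists_eq_pow_mul {f : ℂ → ℂ} (hf : IsExpType f) (hne : ∃ z, f z ≠ 0) (a : ℂ) :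
    ∃ (m : ℕ) (g : ℂ → ℂ), IsExpType g ∧ g a ≠ 0 ∧ ∀ z, f z = (z - a) ^ m * g z := by
  classical
  have han : AnalyticOnNhd ℂ f univ :=
    Complex.analyticOnNhd_univ_iff_differentiable.2 hf.differentiable
  have htop : analyticOrderAt f a ≠ ⊤ := by
    intro h
    obtain ⟨z, hz⟩ := hne
    have h0 : ∀ᶠ z in 𝓝 a, f z = 0 := analyticOrderAt_eq_top.1 h
    exact hz (congrFun (han.eq_of_eventuallyEq (g := fun _ => 0) analyticOnNhd_const h0) z)
  obtain ⟨g, hga, hg0, hg⟩ := (han a (mem_univ a)).analyticOrderAt_ne_top.1 htop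
  set m := analyticOrderNatAt f a
  have hfg : ∀ z, f z = (z - a) ^ m * Function.update (fun z => f z / (z - a) ^ m) a (g a) z := by
    intro z
    rcases eq_or_ne z a with rfl | hz
    · simpa using hg.self_of_nhds
    · rw [Function.update_of_ne hz, mul_div_cancel₀ _ (pow_ne_zero _ (sub_ne_zero.2 hz))]
  have hd : Differentiable ℂ (Function.update (fun z => f z / (z - a) ^ m) a (g a)) := by
    intro z
    rcases eq_or_ne z a with rfl | hz
    · refine hga.differentiableAt.congr_of_eventuallyEq ?_
      filter_upwards [hg] with y hy
      rcases eq_or_ne y z with rfl | hyz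
      · simp
      · rw [Function.update_of_ne hyz, hy, smul_eq_mul,
          mul_div_cancel_left₀ _ (pow_ne_zero _ (sub_ne_zero.2 hyz))]
    · have : DifferentiableAt ℂ (fun z => f z / (z - a) ^ m) z :=
        (hf.differentiable z).div (by fun_prop) (pow_ne_zero _ (sub_ne_zero.2 hz))
      refine this.congr_of_eventuallyEq ?_
      filter_upwards [isOpen_ne.mem_nhds hz] with y hy
      rw [Function.update_of_ne hy]
  refine ⟨m, _, ⟨hd, ?_⟩, by simpa using hg0, hfg⟩
  obtain ⟨A, C, hA, hC, hb⟩ := hf.growth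
  obtain ⟨K, hK⟩ := (isCompact_closedBall a 1).exists_bound_of_continuousOn hd.continuous.continuousOn
  have hK0 : 0 ≤ K := (norm_nonneg _).trans (hK a (by simp))
  refine ⟨A, C + K, hA, by positivity, fun z => ?_⟩
  have he : 1 ≤ Real.exp (A * ‖z‖) := Real.one_le_exp (by positivity)
  rcases le_total ‖z - a‖ 1 with hz | hz
  · have := hK z (by simpa [dist_eq_norm] using hz)
    nlinarith
  · have h1 := hb z
    rw [hfg z, norm_mul, norm_pow] at h1
    have h2 : 1 ≤ ‖z - a‖ ^ m := one_le_pow₀ hz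
    have h3 := mul_le_mul_of_nonneg_right h2 (norm_nonneg
      (Function.update (fun z => f z / (z - a) ^ m) a (g a) z))
    nlinarith

/-- The zeros are divided out one at a time. Of the polynomial factor `q` only its growth is
recorded, as nothing else is needed later. -/
theorem IsExpType.exists_eq_mul_of_finite_zeros (S : Finset ℂ) :
    ∀ f : ℂ → ℂ, IsExpType f → (∀ z, f z = 0 → z ∈ S) →
      ∃ (q g : ℂ → ℂ), IsExpType g ∧ (∀ z, g z ≠ 0) ∧ (∀ z, f z = q z * g z) ∧
        ∃ (C : ℝ) (d : ℕ), ∀ z, ‖q z‖ ≤ C * (1 + ‖z‖) ^ d := by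
  classical
  induction S using Finset.induction_on with
  | empty =>
    intro f hf hz
    exact ⟨fun _ => 1, f, hf, fun z h => by simpa using hz z h, by simp, 1, 0, by simp⟩
  | insert a S _ ih =>
    intro f hf hz
    obtain ⟨b, hb⟩ := Infinite.exists_notMem_finset (insert a S)
    obtain ⟨m, g, hg, hga, hfg⟩ := hf.exists_eq_pow_mul ⟨b, fun h => hb (hz b h)⟩ a
    obtain ⟨q, k, hk, hk0, hgk, C, d, hq⟩ := ih g hg fun z h => by
      have := hz z (by rw [hfg, h, mul_zero])
      rcases Finset.mem_insert.1 this with rfl | h'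
      · exact absurd h hga
      · exact h'
    refine ⟨fun z => (z - a) ^ m * q z, k, hk, hk0, fun z => by rw [hfg, hgk, mul_assoc],
      (1 + ‖a‖) ^ m * C, m + d, fun z => ?_⟩
    have h1 : ‖z - a‖ ≤ (1 + ‖a‖) * (1 + ‖z‖) := by
      have := norm_sub_le z a
      nlinarith [norm_nonneg z, norm_nonneg a]
    calc ‖(z - a) ^ m * q z‖ ≤ ((1 + ‖a‖) * (1 + ‖z‖)) ^ m * (C * (1 + ‖z‖) ^ d) := by
          rw [norm_mul, norm_pow]
          gcongr
          exact hq z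
      _ = _ := by rw [mul_pow]; ring

/-- The logarithm is a primitive `F` of `g' / g`, normalized at `0`; then `exp (-F) * g` has zero
derivative. -/
theorem _root_.Differentiable.exists_eq_exp {g : ℂ → ℂ} (hg : Differentiable ℂ g)
    (h0 : ∀ z, g z ≠ 0) : ∃ h : ℂ → ℂ, Differentiable ℂ h ∧ ∀ z, g z = Complex.exp (h z) := by
  have hd : Differentiable ℂ fun z => deriv g z / g z := (Differentiable.deriv hg).div hg h0
  obtain ⟨F, hF⟩ := hd.isExactOn_univ.with_val_at 0 (Complex.log (g 0))
  have hF' : ∀ z, HasDerivAt F (deriv g z / g z) z := fun z => hF.2 z (mem_univ z)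
  refine ⟨F, fun z => (hF' z).differentiableAt, fun z => ?_⟩
  have hder : ∀ z, HasDerivAt (fun z => Complex.exp (-F z) * g z) 0 z := by
    intro z
    refine ((hF' z).fun_neg.cexp.fun_mul (hg z).hasDerivAt).congr_deriv ?_
    have := h0 z
    field_simp
    ring
  have hc := is_const_of_deriv_eq_zero (fun z => (hder z).differentiableAt)
    (fun z => (hder z).deriv) z 0
  simp only [hF.1, Complex.exp_neg, Complex.exp_log (h0 0), inv_mul_cancel₀ (h0 0)] at hc
  field_simp [Complex.exp_ne_zero] at hc
  exact hc

/-- Borel–Carathéodory turns the one-sided bound on the real part into a linear bound on `‖h‖`. The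
difference quotient of `h` at `0` is then a bounded entire function, hence constant by Liouville. -/
theorem _root_.Differentiable.affine_of_re_le {h : ℂ → ℂ} (hh : Differentiable ℂ h) {A B : ℝ}
    (hA : 0 ≤ A) (hB : 0 < B) (hre : ∀ z, (h z).re ≤ A * ‖z‖ + B) :
    ∃ a b : ℂ, ∀ z, h z = a * z + b := by
  -- With radius `R = 2 * (‖z‖ + 1)` the ratios `‖z‖ / (R - ‖z‖)` and `(R + ‖z‖) / (R - ‖z‖)` are at
  -- most `1` and `3`.
  have hbound : ∀ z : ℂ, ‖h z‖ ≤ 2 * (A * (2 * (‖z‖ + 1)) + B) + 3 * ‖h 0‖ := by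
    intro z
    have hz := norm_nonneg z
    have hM : 0 < A * (2 * (‖z‖ + 1)) + B := by positivity
    have h1 := Complex.borelCaratheodory (R := 2 * (‖z‖ + 1)) (z := z) hM
      hh.differentiableOn (fun y hy => by
        refine (hre y).trans ?_
        have : ‖y‖ ≤ 2 * (‖z‖ + 1) := (mem_ball_zero_iff.1 hy).le
        gcongr) (by positivity) (by rw [mem_ball_zero_iff]; linarith)
    refine h1.trans (add_le_add ?_ ?_)
    · rw [div_le_iff₀ (by linarith)]
      nlinarith
    · rw [div_le_iff₀ (by linarith)]
      nlinarith [norm_nonneg (h 0)]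
  have hq : Differentiable ℂ (dslope h 0) := by
    rw [← differentiableOn_univ]
    exact (Complex.differentiableOn_dslope univ_mem).2 hh.differentiableOn
  obtain ⟨K, hK⟩ := (isCompact_closedBall (0 : ℂ) 1).exists_bound_of_continuousOn
    hq.continuous.continuousOn
  have hbd : Bornology.IsBounded (range (dslope h 0)) := by
    rw [isBounded_iff_forall_norm_le]
    refine ⟨max K (8 * A + 2 * B + 4 * ‖h 0‖), ?_⟩
    rintro _ ⟨z, rfl⟩
    rcases le_total ‖z‖ 1 with hz | hz
    · exact le_max_of_le_left (hK z (by simpa using hz))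
    · refine le_max_of_le_right ?_
      have hz0 : z ≠ 0 := by rintro rfl; simp at hz; linarith
      rw [dslope_of_ne _ hz0, slope_def_field, norm_div, sub_zero, div_le_iff₀ (by linarith)]
      have := norm_sub_le (h z) (h 0)
      have := hbound z
      nlinarith [norm_nonneg (h 0)]
  obtain ⟨a, ha⟩ := hq.exists_const_forall_eq_of_bounded hbd
  refine ⟨a, h 0, fun z => ?_⟩
  have := sub_smul_dslope h 0 z
  rw [ha, smul_eq_mul] at this
  linear_combination -this

/-- An odd entire function of exponential type that grows exponentially along the positive axis has
infinitely many zeros. -/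
theorem IsExpType.infinite_zeros {f : ℂ → ℂ} (hf : IsExpType f) (hodd : ∀ z, f (-z) = -f z)
    {m η : ℝ} (hm : 0 < m) (hη : 0 < η)
    (hlow : ∀ x : ℝ, 0 ≤ x → m * (Real.exp (η * x) - 1) ≤ ‖f x‖) :
    {z | f z = 0}.Infinite := by
  intro hfin
  obtain ⟨q, g, hg, hg0, hfg, C, d, hq⟩ :=
    exists_eq_mul_of_finite_zeros hfin.toFinset f hf (fun z hz => by simpa using hz)
  obtain ⟨h, hh, hgh⟩ := hg.differentiable.exists_eq_exp hg0
  obtain ⟨A, B, hA, hB, hb⟩ := hg.growth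
  obtain ⟨a, b, hab⟩ := hh.affine_of_re_le (A := A) (B := B + 1) hA (by positivity) fun z => by
    have h1 := hb z
    rw [hgh, Complex.norm_exp] at h1
    have h2 : Real.exp (h z).re ≤ Real.exp (A * ‖z‖ + (B + 1)) := by
      refine h1.trans ?_
      rw [add_comm, Real.exp_add]
      gcongr
      linarith [Real.add_one_le_exp (B + 1)]
    exact Real.exp_le_exp.1 h2
  have hC : 0 ≤ C := by simpa using (norm_nonneg _).trans (hq 0)
  -- `exp (a * z)` has modulus at most one on at least one real half-axis; oddness carries the
  -- resulting polynomial bound to the positive one.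
  have hup : ∀ x : ℝ, 0 ≤ x → ‖f x‖ ≤ C * (1 + x) ^ d * Real.exp b.re := by
    have key : ∀ z : ℂ, a.re * z.re ≤ 0 → z.im = 0 →
        ‖f z‖ ≤ C * (1 + ‖z‖) ^ d * Real.exp b.re := by
      intro z hz him
      rw [hfg, norm_mul, hgh, Complex.norm_exp, hab]
      refine mul_le_mul (hq z) (Real.exp_le_exp.2 ?_) (Real.exp_pos _).le (by positivity)
      simpa [him] using hz
    intro x hx
    have hnx : ‖(x : ℂ)‖ = x := by simp [abs_of_nonneg hx]
    rcases le_total a.re 0 with ha | ha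
    · have := key x (by simpa using mul_nonpos_of_nonpos_of_nonneg ha hx) (by simp)
      rwa [hnx] at this
    · have := key (-x) (by simpa using mul_nonneg ha hx) (by simp)
      rwa [hodd, norm_neg, norm_neg, hnx] at this
  -- The upper and lower bounds for `‖f x‖`, divided by `exp (η * x)`. Writing the exponential in
  -- terms of `1 + x` matches it with the power `(1 + x) ^ d`, at the cost of a factor `exp η`.
  have hlim : Tendsto (fun x : ℝ => C * Real.exp b.re * Real.exp η *
      ((1 + x) ^ d / Real.exp (η * (1 + x))) + m * Real.exp (-η * x)) atTop (𝓝 0) := by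
    have h1 : Tendsto (fun x : ℝ => 1 + x) atTop atTop := tendsto_atTop_add_const_left _ _ tendsto_id
    have h2 := ((isLittleO_pow_exp_pos_mul_atTop d hη).tendsto_div_nhds_zero).comp h1
    have h3 : Tendsto (fun x : ℝ => Real.exp (-η * x)) atTop (𝓝 0) :=
      Real.tendsto_exp_atBot.comp (tendsto_id.const_mul_atTop_of_neg (by linarith))
    simpa using (h2.const_mul (C * Real.exp b.re * Real.exp η)).add (h3.const_mul m)
  obtain ⟨x, hx, hx0⟩ := ((hlim.eventually (gt_mem_nhds hm)).and (eventually_ge_atTop 0)).exists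
  have h1 := (hlow x hx0).trans (hup x hx0)
  have e1 : Real.exp (η * (1 + x)) = Real.exp η * Real.exp (η * x) := by
    rw [← Real.exp_add]; ring_nf
  have e2 : Real.exp (-η * x) = (Real.exp (η * x))⁻¹ := by
    rw [← Real.exp_neg]; ring_nf
  rw [e1, e2] at hx
  have hp := Real.exp_pos (η * x)
  have hp' := Real.exp_pos η
  have e3 : C * Real.exp b.re * Real.exp η * ((1 + x) ^ d / (Real.exp η * Real.exp (η * x))) +
      m * (Real.exp (η * x))⁻¹ = (C * (1 + x) ^ d * Real.exp b.re + m) / Real.exp (η * x) := by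
    field_simp
  rw [e3, div_lt_iff₀ hp] at hx
  linarith

variable {n : ℕ} {δ : ℝ}

/-! ### The symbol of the nonlocal gradient on exponentials -/

theorem kernel_eq_of_norm_eq {s : ℝ} (w : CutOff n δ) {y y' : EuclideanSpace ℝ (Fin n)}
    (h : ‖y‖ = ‖y'‖) : kernel s w y = kernel s w y' := by
  obtain ⟨wbar, -, hw⟩ := w.radial
  simp [kernel, hw, h]

/-- The weight `ρ(y) / |y|² * y_j` of the `j`-th component of the nonlocal gradient. -/
def gradWeight (s : ℝ) (w : CutOff n δ) (j : Fin n) (y : EuclideanSpace ℝ (Fin n)) : ℝ :=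
  kernel s w y * ((‖y‖⁻¹) ^ 2 * y j)

theorem measurable_kernel (s : ℝ) (w : CutOff n δ) : Measurable (kernel s w) :=
  (w.smooth.continuous.measurable.div (measurable_norm.pow_const _)).const_mul _

theorem measurable_gradWeight (s : ℝ) (w : CutOff n δ) (j : Fin n) :
    Measurable (gradWeight s w j) := by
  refine (measurable_kernel s w).mul ((measurable_norm.inv.pow_const _).mul ?_)
  exact (EuclideanSpace.proj (𝕜 := ℝ) j).continuous.measurable

/-- The weight is one order more singular at the origin than the integrable kernel. Each use below
supplies the missing factor `‖y‖`, for instance from `exp (z * y_i) - 1`. -/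
theorem abs_gradWeight_mul_norm_le {s : ℝ} (w : CutOff n δ) (j : Fin n)
    (y : EuclideanSpace ℝ (Fin n)) : |gradWeight s w j y| * ‖y‖ ≤ |kernel s w y| := by
  have hj : |y j| ≤ ‖y‖ := PiLp.norm_apply_le y j
  rcases eq_or_ne y 0 with rfl | hy
  · simp
  have h0 : 0 < ‖y‖ := norm_pos_iff.2 hy
  rw [gradWeight, abs_mul, abs_mul, abs_of_nonneg (by positivity : 0 ≤ (‖y‖⁻¹) ^ 2), mul_assoc]
  refine mul_le_of_le_one_right (abs_nonneg _) ?_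
  calc ‖y‖⁻¹ ^ 2 * |y j| * ‖y‖ ≤ ‖y‖⁻¹ ^ 2 * ‖y‖ * ‖y‖ := by gcongr
    _ = 1 := by field_simp

/-- The `j`-th component of the symbol of the nonlocal gradient at `x ↦ exp (z * x_i)`. -/
def expSymbol (s : ℝ) (w : CutOff n δ) (i j : Fin n) (z : ℂ) : ℂ :=
  ∫ y, (gradWeight s w j y : ℂ) * (Complex.exp (z * (y i : ℂ)) - 1)

theorem norm_exp_sub_one_le_mul_exp (a : ℂ) : ‖Complex.exp a - 1‖ ≤ ‖a‖ * Real.exp ‖a‖ := by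
  simpa using Complex.norm_exp_sub_sum_le_norm_mul_exp a 1

/-- The kernel vanishes for `‖y‖ ≥ δ`, so only `‖y‖ < δ` enters the exponent. This one bound gives
both the integrability of the integrand and the exponential type of the symbol. -/
theorem norm_mul_exp_sub_one_le {s : ℝ} (w : CutOff n δ) (i j : Fin n) (z : ℂ)
    (y : EuclideanSpace ℝ (Fin n)) :
    ‖(gradWeight s w j y : ℂ) * (Complex.exp (z * (y i : ℂ)) - 1)‖ ≤
      ‖z‖ * Real.exp (δ * ‖z‖) * |kernel s w y| := by
  have hi : |y i| ≤ ‖y‖ := PiLp.norm_apply_le y i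
  rcases le_or_gt δ ‖y‖ with hy | hy
  · simp [gradWeight, kernel_eq_zero w hy]
  have h1 := norm_exp_sub_one_le_mul_exp (z * (y i : ℂ))
  rw [norm_mul, Complex.norm_real, Real.norm_eq_abs] at h1
  rw [norm_mul, Complex.norm_real, Real.norm_eq_abs]
  calc |gradWeight s w j y| * ‖Complex.exp (z * (y i : ℂ)) - 1‖
      ≤ |gradWeight s w j y| * (‖z‖ * ‖y‖ * Real.exp (‖z‖ * δ)) := by
        refine mul_le_mul_of_nonneg_left (h1.trans ?_) (abs_nonneg _)
        have := hi.trans hy.le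
        gcongr
    _ = ‖z‖ * Real.exp (δ * ‖z‖) * (|gradWeight s w j y| * ‖y‖) := by rw [mul_comm δ]; ring
    _ ≤ _ := by
        gcongr
        exact abs_gradWeight_mul_norm_le w j y

theorem measurable_mul_exp_sub_one (s : ℝ) (w : CutOff n δ) (i j : Fin n) (z : ℂ) :
    Measurable fun y : EuclideanSpace ℝ (Fin n) =>
      (gradWeight s w j y : ℂ) * (Complex.exp (z * (y i : ℂ)) - 1) := by
  refine (Complex.measurable_ofReal.comp (measurable_gradWeight s w j)).mul ?_
  exact Continuous.measurable (by fun_prop)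

theorem integrable_mul_exp_sub_one {s : ℝ} (hs : s ∈ Ioo (0 : ℝ) 1) (w : CutOff n δ)
    (i j : Fin n) (z : ℂ) :
    Integrable fun y : EuclideanSpace ℝ (Fin n) =>
      (gradWeight s w j y : ℂ) * (Complex.exp (z * (y i : ℂ)) - 1) :=
  Integrable.mono' ((kernel_integrable hs w).abs.const_mul _)
    (measurable_mul_exp_sub_one s w i j z).aestronglyMeasurable
    (ae_of_all _ (norm_mul_exp_sub_one_le w i j z))

theorem differentiable_expSymbol {s : ℝ} (hs : s ∈ Ioo (0 : ℝ) 1) (w : CutOff n δ)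
    (i j : Fin n) : Differentiable ℂ (expSymbol s w i j) := by
  intro z₀
  refine (hasDerivAt_integral_of_dominated_loc_of_deriv_le (𝕜 := ℂ) (x₀ := z₀)
    (s := ball z₀ 1)
    (F := fun z y => (gradWeight s w j y : ℂ) * (Complex.exp (z * (y i : ℂ)) - 1))
    (F' := fun z y => (gradWeight s w j y : ℂ) * (Complex.exp (z * (y i : ℂ)) * (y i : ℂ)))
    (bound := fun y => Real.exp (δ * (‖z₀‖ + 1)) * |kernel s w y|)
    (ball_mem_nhds _ one_pos) (Eventually.of_forall fun z => ?_) ?_ ?_ ?_ ?_ ?_).2.differentiableAt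
  · exact (measurable_mul_exp_sub_one s w i j z).aestronglyMeasurable
  · exact integrable_mul_exp_sub_one hs w i j z₀
  · refine ((Complex.measurable_ofReal.comp (measurable_gradWeight s w j)).mul
      (Continuous.measurable (by fun_prop))).aestronglyMeasurable
  · refine ae_of_all _ fun y z hz => ?_
    have hi : |y i| ≤ ‖y‖ := PiLp.norm_apply_le y i
    rcases le_or_gt δ ‖y‖ with hy | hy
    · simp [gradWeight, kernel_eq_zero w hy]
    have hz' : ‖z‖ ≤ ‖z₀‖ + 1 := by
      have h1 := norm_sub_norm_le z z₀
      have h2 := mem_ball_iff_norm.1 hz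
      linarith
    have he : ‖Complex.exp (z * (y i : ℂ))‖ ≤ Real.exp (δ * (‖z₀‖ + 1)) := by
      refine (Complex.norm_exp_le_exp_norm _).trans (Real.exp_le_exp.2 ?_)
      rw [norm_mul, Complex.norm_real, Real.norm_eq_abs, mul_comm δ]
      have := hi.trans hy.le
      gcongr
    rw [norm_mul, norm_mul, Complex.norm_real, Complex.norm_real, Real.norm_eq_abs,
      Real.norm_eq_abs]
    calc |gradWeight s w j y| * (‖Complex.exp (z * (y i : ℂ))‖ * |y i|)
        ≤ |gradWeight s w j y| * (Real.exp (δ * (‖z₀‖ + 1)) * ‖y‖) := by gcongr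
      _ = Real.exp (δ * (‖z₀‖ + 1)) * (|gradWeight s w j y| * ‖y‖) := by ring
      _ ≤ _ := by
        gcongr
        exact abs_gradWeight_mul_norm_le w j y
  · exact (kernel_integrable hs w).abs.const_mul _
  · refine ae_of_all _ fun y z _ => ?_
    have : HasDerivAt (fun z : ℂ => z * (y i : ℂ)) (y i : ℂ) z := by
      simpa using (hasDerivAt_id z).mul_const (y i : ℂ)
    exact (this.cexp.sub_const 1).const_mul _

theorem isExpType_expSymbol {s : ℝ} (hs : s ∈ Ioo (0 : ℝ) 1) (hδ : 0 ≤ δ) (w : CutOff n δ)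
    (i j : Fin n) : IsExpType (expSymbol s w i j) := by
  -- The extra `1` in the type absorbs the factor `‖z‖ ≤ exp ‖z‖`.
  refine ⟨differentiable_expSymbol hs w i j, δ + 1, ∫ y, |kernel s w y|, by positivity,
    by positivity, fun z => ?_⟩
  refine (norm_integral_le_of_norm_le ((kernel_integrable hs w).abs.const_mul _)
    (ae_of_all _ (norm_mul_exp_sub_one_le w i j z))).trans ?_
  rw [integral_const_mul, mul_comm]
  refine mul_le_mul_of_nonneg_left ?_ (by positivity)
  rw [add_mul, one_mul, Real.exp_add, mul_comm]
  gcongr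
  linarith [Real.add_one_le_exp ‖z‖]

/-- The weight is odd in `y`, while replacing both `z` and `y` by their negatives leaves the
exponential unchanged. -/
theorem expSymbol_neg {s : ℝ} (w : CutOff n δ) (i : Fin n) (z : ℂ) :
    expSymbol s w i i (-z) = -expSymbol s w i i z := by
  rw [expSymbol, expSymbol, ← integral_neg, ← integral_neg_eq_self]
  refine integral_congr_ae (ae_of_all _ fun y => ?_)
  simp [gradWeight, kernel_eq_of_norm_eq w (norm_neg y)]

/-- The symbol of a function of `x_i` has no component orthogonal to the `i`-th axis. -/
theorem expSymbol_eq_zero_of_ne {s : ℝ} (w : CutOff n δ) {i j : Fin n} (hij : j ≠ i) (z : ℂ) :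
    expSymbol s w i j z = 0 := by
  classical
  -- Reflection in the `j`-th coordinate: it flips the sign of the weight and fixes `y i`, so the
  -- integral equals its own negative.
  let R : EuclideanSpace ℝ (Fin n) ≃ₗᵢ[ℝ] EuclideanSpace ℝ (Fin n) :=
    LinearIsometryEquiv.piLpCongrRight 2 fun k =>
      if k = j then LinearIsometryEquiv.neg ℝ else LinearIsometryEquiv.refl ℝ ℝ
  have hj : ∀ y, R y j = -y j := fun y => by simp [R]
  have hi : ∀ y, R y i = y i := fun y => by simp [R, hij.symm]
  have h : expSymbol s w i j z = -expSymbol s w i j z := by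
    conv_lhs => rw [expSymbol, ← R.measurePreserving.integral_comp
      R.toHomeomorph.measurableEmbedding]
    rw [expSymbol, ← integral_neg]
    refine integral_congr_ae (ae_of_all _ fun y => ?_)
    simp [gradWeight, hi, hj, kernel_eq_of_norm_eq w (R.norm_map y)]
  linear_combination h / 2

theorem cutOff_quotient_integrable {s : ℝ} (hs : s ∈ Ioo (0 : ℝ) 1) (hn : 1 ≤ n) (w : CutOff n δ) :
    IntegrableOn (fun z : EuclideanSpace ℝ (Fin n) => w.toFun z / ‖z‖ ^ ((n : ℝ) + s - 1))
      (ball 0 δ) := by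
  obtain ⟨C, hC⟩ := w.hasCompactSupport.exists_bound_of_continuous w.smooth.continuous
  refine integrableOn_ball_of_norm_le_rpow (C := C) (α := (n : ℝ) + s - 1) (by simpa using hn) ?_
    (ae_of_all _ fun z => ?_)
    (w.smooth.continuous.measurable.div (measurable_norm.pow_const _)).aestronglyMeasurable
  · simp only [finrank_euclideanSpace, Fintype.card_fin]
    linarith [hs.2]
  · rw [norm_div, Real.rpow_neg (norm_nonneg _), div_eq_mul_inv,
      Real.norm_of_nonneg (Real.rpow_nonneg (norm_nonneg z) _)]
    exact mul_le_mul_of_nonneg_right (hC z) (inv_nonneg.2 (Real.rpow_nonneg (norm_nonneg z) _))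

/-- A ball off the origin on which the cut-off is one and the `i`-th coordinate is large. -/
theorem exists_ball_cutOff_eq_one (hδ : 0 < δ) (w : CutOff n δ) (i : Fin n) :
    ∃ (x₀ : EuclideanSpace ℝ (Fin n)) (η : ℝ), 0 < η ∧
      ∀ y ∈ ball x₀ η, y ∈ ball (0 : EuclideanSpace ℝ (Fin n)) δ ∧ w.toFun y = 1 ∧ η ≤ y i := by
  obtain ⟨μ, hμ, h1⟩ := w.eq_one
  have hpos : 0 < μ * δ := mul_pos hμ.1 hδ
  -- In the ball of radius `μδ/4` about `(μδ/2) e_i` one has `‖y‖ < 3μδ/4` and `y i > μδ/4`.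
  refine ⟨EuclideanSpace.single i (μ * δ / 2), μ * δ / 4, by positivity, fun y hy => ?_⟩
  rw [mem_ball_iff_norm] at hy
  have hn : ‖y‖ < μ * δ := by
    have h2 := norm_sub_norm_le y (EuclideanSpace.single i (μ * δ / 2))
    rw [PiLp.norm_single, Real.norm_of_nonneg (by positivity)] at h2
    linarith
  refine ⟨?_, h1 y (by simpa using hn), ?_⟩
  · rw [mem_ball_zero_iff]
    nlinarith [hμ.2]
  · have h3 := (PiLp.norm_apply_le (y - EuclideanSpace.single i (μ * δ / 2)) i).trans hy.le
    simp only [PiLp.sub_apply, PiLp.single_apply, if_true, Real.norm_eq_abs] at h3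
    linarith [(abs_le.1 h3).1]

theorem scalingConstant_pos {s : ℝ} (hs : s ∈ Ioo (0 : ℝ) 1) (hδ : 0 < δ) (w : CutOff n δ)
    (i : Fin n) : 0 < scalingConstant s w := by
  have hn : 0 < n := i.pos
  refine div_pos (by exact_mod_cast hn) ?_
  rw [setIntegral_pos_iff_support_of_nonneg_ae
    (ae_of_all _ fun z => div_nonneg (w.nonneg z) (Real.rpow_nonneg (norm_nonneg z) _))
    (cutOff_quotient_integrable hs hn w)]
  obtain ⟨x₀, η, hη, h⟩ := exists_ball_cutOff_eq_one hδ w i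
  refine (measure_ball_pos volume x₀ hη).trans_le (measure_mono fun y hy => ?_)
  obtain ⟨hy1, hy2, hy3⟩ := h y hy
  refine ⟨?_, hy1⟩
  have : 0 < ‖y‖ := (hη.trans_le hy3).trans_le ((le_abs_self _).trans (PiLp.norm_apply_le y i))
  rw [Function.mem_support, hy2]
  positivity

theorem kernel_nonneg {s : ℝ} (hs : s ∈ Ioo (0 : ℝ) 1) (hδ : 0 < δ) (w : CutOff n δ) (i : Fin n)
    (y : EuclideanSpace ℝ (Fin n)) : 0 ≤ kernel s w y :=
  mul_nonneg (scalingConstant_pos hs hδ w i).le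
    (div_nonneg (w.nonneg y) (Real.rpow_nonneg (norm_nonneg y) _))

/-- For real `x ≥ 0` the factors `y i` and `exp (x * y i) - 1` have the same sign, so the integrand
is nonnegative. Discarding all but a ball on which `y i ≥ η` leaves the claimed lower bound, with
`m` the mass of the weight there. -/
theorem exists_exp_le_norm_expSymbol {s : ℝ} (hs : s ∈ Ioo (0 : ℝ) 1) (hδ : 0 < δ)
    (w : CutOff n δ) (i : Fin n) :
    ∃ m η : ℝ, 0 < m ∧ 0 < η ∧ ∀ x : ℝ, 0 ≤ x →
      m * (Real.exp (η * x) - 1) ≤ ‖expSymbol s w i i x‖ := by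
  obtain ⟨x₀, η, hη, h⟩ := exists_ball_cutOff_eq_one hδ w i
  have hnorm : ∀ y ∈ ball x₀ η, η ≤ ‖y‖ := fun y hy =>
    (h y hy).2.2.trans ((le_abs_self _).trans (PiLp.norm_apply_le y i))
  have hpos : ∀ y ∈ ball x₀ η, 0 < gradWeight s w i y := by
    intro y hy
    obtain ⟨-, h2, h3⟩ := h y hy
    have h0 : 0 < ‖y‖ := hη.trans_le (hnorm y hy)
    have hi : 0 < y i := hη.trans_le h3
    have := scalingConstant_pos hs hδ w i
    rw [gradWeight, kernel, h2]
    positivity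
  -- On this ball `‖y‖ ≥ η`, so the weight is dominated by the kernel divided by `η`.
  have hint : IntegrableOn (gradWeight s w i) (ball x₀ η) := by
    refine Integrable.mono' ((kernel_integrable hs w).abs.mul_const η⁻¹).integrableOn
      (measurable_gradWeight s w i).aestronglyMeasurable ?_
    refine (ae_restrict_iff' measurableSet_ball).2 (ae_of_all _ fun y hy => ?_)
    rw [← div_eq_mul_inv, le_div_iff₀ hη]
    exact (mul_le_mul_of_nonneg_left (hnorm y hy) (norm_nonneg _)).trans
      (abs_gradWeight_mul_norm_le w i y)
  refine ⟨∫ y in ball x₀ η, gradWeight s w i y, η, ?_, hη, fun x hx => ?_⟩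
  · rw [setIntegral_pos_iff_support_of_nonneg_ae
      ((ae_restrict_iff' measurableSet_ball).2 (ae_of_all _ fun y hy => (hpos y hy).le)) hint]
    exact (measure_ball_pos volume x₀ hη).trans_le
      (measure_mono fun y hy => ⟨(hpos y hy).ne', hy⟩)
  · have hre : ∀ y : EuclideanSpace ℝ (Fin n),
        (gradWeight s w i y : ℂ) * (Complex.exp ((x : ℂ) * (y i : ℂ)) - 1) =
          ((gradWeight s w i y * (Real.exp (x * y i) - 1) : ℝ) : ℂ) := fun y => by push_cast; rfl
    have hI : Integrable fun y : EuclideanSpace ℝ (Fin n) =>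
        gradWeight s w i y * (Real.exp (x * y i) - 1) := by
      have := (integrable_mul_exp_sub_one hs w i i x).re
      refine this.congr (ae_of_all _ fun y => ?_)
      simp only [hre]
      exact Complex.ofReal_re _
    have hnn : ∀ y : EuclideanSpace ℝ (Fin n),
        0 ≤ gradWeight s w i y * (Real.exp (x * y i) - 1) := by
      intro y
      rw [gradWeight, mul_assoc, mul_assoc]
      refine mul_nonneg (kernel_nonneg hs hδ w i y) (mul_nonneg (by positivity) ?_)
      rcases le_total 0 (y i) with hy | hy
      · exact mul_nonneg hy (sub_nonneg.2 (Real.one_le_exp (mul_nonneg hx hy)))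
      · exact mul_nonneg_of_nonpos_of_nonpos hy
          (sub_nonpos.2 (Real.exp_le_one_iff.2 (mul_nonpos_of_nonneg_of_nonpos hx hy)))
    rw [expSymbol, integral_congr_ae (ae_of_all _ hre), integral_complex_ofReal, Complex.norm_real,
      Real.norm_of_nonneg (integral_nonneg hnn), ← integral_mul_const]
    refine le_trans ?_ (setIntegral_le_integral hI (ae_of_all _ hnn) (s := ball x₀ η))
    refine setIntegral_mono_on (hint.mul_const _) hI.integrableOn measurableSet_ball fun y hy => ?_
    refine mul_le_mul_of_nonneg_left (sub_le_sub_right (Real.exp_le_exp.2 ?_) _) (hpos y hy).le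
    rw [mul_comm]
    exact mul_le_mul_of_nonneg_left (h y hy).2.2 hx

theorem infinite_zeros_expSymbol {s : ℝ} (hs : s ∈ Ioo (0 : ℝ) 1) (hδ : 0 < δ) (w : CutOff n δ)
    (i : Fin n) : {z | expSymbol s w i i z = 0}.Infinite := by
  obtain ⟨m, η, hm, hη, h⟩ := exists_exp_le_norm_expSymbol hs hδ w i
  exact (isExpType_expSymbol hs hδ.le w i i).infinite_zeros (expSymbol_neg w i) hm hη h

/-! ### Exponentials in the kernel of the nonlocal gradient -/

/-- The complex exponential `x ↦ exp (z * x_i)`. -/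
def coordExp (i : Fin n) (z : ℂ) (x : EuclideanSpace ℝ (Fin n)) : ℂ :=
  Complex.exp (z * (x i : ℂ))

theorem continuous_coordExp (i : Fin n) (z : ℂ) : Continuous (coordExp i z) := by
  unfold coordExp
  fun_prop

theorem coordExp_add (i : Fin n) (z : ℂ) (x y : EuclideanSpace ℝ (Fin n)) :
    coordExp i z (x + y) = coordExp i z x * coordExp i z y := by
  simp [coordExp, mul_add, Complex.exp_add]

theorem inner_mul_kernel_eq_sum {s : ℝ} (w : CutOff n δ) (v y : EuclideanSpace ℝ (Fin n)) :
    inner ℝ (‖y‖⁻¹ • v) (‖y‖⁻¹ • y) * kernel s w y = ∑ j, v j * gradWeight s w j y := by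
  rw [real_inner_smul_left, real_inner_smul_right, PiLp.inner_apply, Finset.mul_sum,
    Finset.mul_sum, Finset.sum_mul]
  refine Finset.sum_congr rfl fun j _ => ?_
  simp only [gradWeight, RCLike.inner_apply, conj_trivial]
  ring

theorem nonlocalDiv_eq (s : ℝ) (w : CutOff n δ)
    (ψ : EuclideanSpace ℝ (Fin n) → EuclideanSpace ℝ (Fin n)) (x : EuclideanSpace ℝ (Fin n)) :
    nonlocalDiv s w ψ x =
      ∫ y, inner ℝ (‖y‖⁻¹ • (ψ x - ψ (x - y))) (‖y‖⁻¹ • y) * kernel s w y := by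
  rw [nonlocalDiv, ← integral_sub_left_eq_self _ volume x]
  simp

/-- This is what justifies Fubini. The Lipschitz bound on `ψ` cancels the extra singularity, and the
integrand vanishes unless `x` lies within `|δ|` of a ball containing the support of `ψ`; a product
of a function of `x` and one of `y` dominates. -/
theorem integrable_coordExp_mul_integrand {s : ℝ} (hs : s ∈ Ioo (0 : ℝ) 1) (w : CutOff n δ)
    {ψ : EuclideanSpace ℝ (Fin n) → EuclideanSpace ℝ (Fin n)} (hψ : ContDiff ℝ ∞ ψ)
    (hc : HasCompactSupport ψ) (i : Fin n) (z : ℂ) :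
    Integrable (Function.uncurry fun x y => coordExp i z x *
      ((inner ℝ (‖y‖⁻¹ • (ψ x - ψ (x - y))) (‖y‖⁻¹ • y) * kernel s w y : ℝ) : ℂ))
      ((volume : Measure (EuclideanSpace ℝ (Fin n))).prod volume) := by
  obtain ⟨L, hL⟩ := hψ.lipschitzWith_of_hasCompactSupport hc (by simp)
  obtain ⟨R, -, hR⟩ := hc.exists_pos_le_norm
  set B : Set (EuclideanSpace ℝ (Fin n)) := closedBall 0 (R + |δ|)
  have h1 : Integrable (B.indicator fun x => ‖coordExp i z x‖) :=
    (integrable_indicator_iff measurableSet_closedBall).2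
      ((continuous_coordExp i z).norm.continuousOn.integrableOn_compact (isCompact_closedBall _ _))
  have h2 : Integrable fun y => (L : ℝ) * ‖kernel s w y‖ := (kernel_integrable hs w).norm.const_mul _
  refine Integrable.mono' (h1.mul_prod h2) ?_ (ae_of_all _ fun q => ?_)
  · have m1 : Measurable fun q : EuclideanSpace ℝ (Fin n) × EuclideanSpace ℝ (Fin n) =>
        ψ q.1 - ψ (q.1 - q.2) := by
      have := hψ.continuous
      exact Continuous.measurable (by fun_prop)
    have m2 : Measurable fun q : EuclideanSpace ℝ (Fin n) × EuclideanSpace ℝ (Fin n) =>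
        ‖q.2‖⁻¹ := measurable_snd.norm.inv
    have m3 := ((m2.smul m1).inner (𝕜 := ℝ) (m2.smul measurable_snd)).mul
      ((measurable_kernel s w).comp measurable_snd)
    exact (((continuous_coordExp i z).measurable.comp measurable_fst).mul
      (Complex.measurable_ofReal.comp m3)).aestronglyMeasurable
  · obtain ⟨x, y⟩ := q
    simp only [Function.uncurry_apply_pair, norm_mul (coordExp i z x), Complex.norm_real]
    have hb := nonlocalDiv_integrand_bound (s := s) w hL x (x - y)
    rw [sub_sub_cancel] at hb
    by_cases hx : x ∈ B
    · rw [indicator_of_mem hx]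
      exact mul_le_mul_of_nonneg_left hb (norm_nonneg _)
    · rw [indicator_of_notMem hx, zero_mul]
      have hxR : R + |δ| < ‖x‖ := by simpa [B] using hx
      have hx0 : ψ x = 0 := hR x (by linarith [abs_nonneg δ])
      have : inner ℝ (‖y‖⁻¹ • (ψ x - ψ (x - y))) (‖y‖⁻¹ • y) * kernel s w y = 0 := by
        rcases le_or_gt δ ‖y‖ with hy | hy
        · rw [kernel_eq_zero w hy, mul_zero]
        · have := norm_sub_norm_le x y
          rw [hx0, hR (x - y) (by linarith [le_abs_self δ])]
          simp
      rw [this]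
      simp

theorem integrable_coordExp_mul_nonlocalDiv {s : ℝ} (hs : s ∈ Ioo (0 : ℝ) 1) (w : CutOff n δ)
    {ψ : EuclideanSpace ℝ (Fin n) → EuclideanSpace ℝ (Fin n)} (hψ : ContDiff ℝ ∞ ψ)
    (hc : HasCompactSupport ψ) (i : Fin n) (z : ℂ) :
    Integrable fun x => coordExp i z x * (nonlocalDiv s w ψ x : ℂ) := by
  refine (integrable_coordExp_mul_integrand hs w hψ hc i z).integral_prod_left.congr
    (ae_of_all _ fun x => ?_)
  simp only [Function.uncurry_apply_pair]
  rw [integral_const_mul, integral_complex_ofReal, nonlocalDiv_eq]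

/-- After Fubini the `x`-integral is taken first. For fixed `y` the difference `ψ x - ψ (x - y)` may
be split, and translating by `y` turns the second term into `exp (z * y_i)` times the first. The
combined factor `1 - exp (z * y_i)` makes the remaining `y`-integral converge, to minus the symbol.
-/
theorem integral_coordExp_mul_nonlocalDiv {s : ℝ} (hs : s ∈ Ioo (0 : ℝ) 1) (w : CutOff n δ)
    {ψ : EuclideanSpace ℝ (Fin n) → EuclideanSpace ℝ (Fin n)} (hψ : ContDiff ℝ ∞ ψ)
    (hc : HasCompactSupport ψ) (i : Fin n) (z : ℂ) :
    ∫ x, coordExp i z x * (nonlocalDiv s w ψ x : ℂ) =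
      -∑ j, (∫ x, coordExp i z x * (ψ x j : ℂ)) * expSymbol s w i j z := by
  have hcont : ∀ j, Continuous fun x => (ψ x j : ℂ) := fun j => by
    have := hψ.continuous
    fun_prop
  have hint : ∀ j y, Integrable fun x => coordExp i z x * (ψ (x - y) j : ℂ) := by
    intro j y
    refine Continuous.integrable_of_hasCompactSupport
      ((continuous_coordExp i z).mul ((hcont j).comp (continuous_sub_right y))) ?_
    refine HasCompactSupport.mul_left ?_
    have h1 : HasCompactSupport fun x => ψ (x - y) := by
      exact hc.comp_homeomorph (Homeomorph.subRight y)
    exact h1.comp_left (g := fun v : EuclideanSpace ℝ (Fin n) => (v j : ℂ)) (by simp)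
  have hint0 : ∀ j, Integrable fun x => coordExp i z x * (ψ x j : ℂ) := fun j => by
    simpa using hint j 0
  have hsub : ∀ j y, Integrable fun x =>
      coordExp i z x * (ψ x j : ℂ) - coordExp i z x * (ψ (x - y) j : ℂ) :=
    fun j y => (hint0 j).sub (hint j y)
  have hshift : ∀ j y, ∫ x, coordExp i z x * (ψ (x - y) j : ℂ) =
      coordExp i z y * ∫ x, coordExp i z x * (ψ x j : ℂ) := by
    intro j y
    rw [← integral_add_right_eq_self _ y, ← integral_const_mul]
    refine integral_congr_ae (ae_of_all _ fun x => ?_)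
    simp only [add_sub_cancel_right, coordExp_add]
    ring
  have hinner : ∀ y, ∫ x, coordExp i z x *
      ((inner ℝ (‖y‖⁻¹ • (ψ x - ψ (x - y))) (‖y‖⁻¹ • y) * kernel s w y : ℝ) : ℂ) =
      ∑ j, -((∫ x, coordExp i z x * (ψ x j : ℂ)) *
        ((gradWeight s w j y : ℂ) * (Complex.exp (z * (y i : ℂ)) - 1))) := by
    intro y
    have : ∀ x, coordExp i z x *
        ((inner ℝ (‖y‖⁻¹ • (ψ x - ψ (x - y))) (‖y‖⁻¹ • y) * kernel s w y : ℝ) : ℂ) =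
        ∑ j, (coordExp i z x * (ψ x j : ℂ) - coordExp i z x * (ψ (x - y) j : ℂ)) *
          (gradWeight s w j y : ℂ) := by
      intro x
      rw [inner_mul_kernel_eq_sum]
      push_cast
      rw [Finset.mul_sum]
      refine Finset.sum_congr rfl fun j _ => ?_
      simp only [PiLp.sub_apply]
      push_cast
      ring
    rw [integral_congr_ae (ae_of_all _ this), integral_finsetSum _ fun j _ =>
      (hsub j y).mul_const _]
    refine Finset.sum_congr rfl fun j _ => ?_
    rw [integral_mul_const, integral_sub (hint0 j) (hint j y), hshift, coordExp]
    ring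
  calc ∫ x, coordExp i z x * (nonlocalDiv s w ψ x : ℂ)
      = ∫ x, ∫ y, coordExp i z x *
        ((inner ℝ (‖y‖⁻¹ • (ψ x - ψ (x - y))) (‖y‖⁻¹ • y) * kernel s w y : ℝ) : ℂ) := by
        refine integral_congr_ae (ae_of_all _ fun x => ?_)
        simp only
        rw [integral_const_mul, integral_complex_ofReal, nonlocalDiv_eq]
    _ = ∫ y, ∑ j, -((∫ x, coordExp i z x * (ψ x j : ℂ)) *
        ((gradWeight s w j y : ℂ) * (Complex.exp (z * (y i : ℂ)) - 1))) := by
        rw [integral_integral_swap (integrable_coordExp_mul_integrand hs w hψ hc i z)]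
        exact integral_congr_ae (ae_of_all _ hinner)
    _ = _ := by
        rw [integral_finsetSum _ fun j _ =>
          ((integrable_mul_exp_sub_one hs w i j z).const_mul _).fun_neg, ← Finset.sum_neg_distrib]
        refine Finset.sum_congr rfl fun j _ => ?_
        rw [integral_neg, integral_const_mul, expSymbol]

/-- Lets integrals over the enlarged set be replaced by integrals over the whole space, where
translations are available. -/
theorem nonlocalDiv_eq_zero_of_notMem_enlarged {s : ℝ} (hδ : 0 < δ) (w : CutOff n δ)
    {Ω : TopologicalSpace.Opens (EuclideanSpace ℝ (Fin n))}
    {ψ : EuclideanSpace ℝ (Fin n) → EuclideanSpace ℝ (Fin n)} (hψ : tsupport ψ ⊆ Ω)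
    {x : EuclideanSpace ℝ (Fin n)} (hx : x ∉ enlarged δ Ω) : nonlocalDiv s w ψ x = 0 := by
  have hψ0 : ∀ y, y ∉ (Ω : Set (EuclideanSpace ℝ (Fin n))) → ψ y = 0 := fun y hy =>
    image_eq_zero_of_notMem_tsupport fun h => hy (hψ h)
  have hx0 : ψ x = 0 := hψ0 x fun h => hx (self_subset_thickening hδ _ h)
  refine integral_eq_zero_of_ae (ae_of_all _ fun y => ?_)
  by_cases hy : y ∈ (Ω : Set (EuclideanSpace ℝ (Fin n)))
  · have : δ ≤ ‖x - y‖ := by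
      by_contra h
      exact hx (mem_thickening_iff.2 ⟨y, hy, by rw [dist_eq_norm]; linarith⟩)
    simp [kernel_eq_zero w this]
  · simp [hx0, hψ0 y hy]

theorem setIntegral_coordExp_mul_nonlocalDiv_eq_zero {s : ℝ} (hs : s ∈ Ioo (0 : ℝ) 1) (hδ : 0 < δ)
    (w : CutOff n δ) {Ω : TopologicalSpace.Opens (EuclideanSpace ℝ (Fin n))}
    {ψ : EuclideanSpace ℝ (Fin n) → EuclideanSpace ℝ (Fin n)} (hψ : ContDiff ℝ ∞ ψ)
    (hc : HasCompactSupport ψ) (hsub : tsupport ψ ⊆ Ω) {i : Fin n} {z : ℂ}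
    (hz : expSymbol s w i i z = 0) :
    ∫ x in enlarged δ Ω, coordExp i z x * (nonlocalDiv s w ψ x : ℂ) = 0 := by
  rw [setIntegral_eq_integral_of_forall_compl_eq_zero fun x hx => by
    rw [nonlocalDiv_eq_zero_of_notMem_enlarged hδ w hsub hx, Complex.ofReal_zero, mul_zero],
    integral_coordExp_mul_nonlocalDiv hs w hψ hc, neg_eq_zero]
  refine Finset.sum_eq_zero fun j _ => ?_
  rcases eq_or_ne j i with rfl | hj
  · rw [hz, mul_zero]
  · rw [expSymbol_eq_zero_of_ne w hj, mul_zero]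

/-- The functional `T` stands for the real or the imaginary part, so that both are treated at once.
-/
theorem memLp_clm_coordExp (p : ℝ≥0∞) {Ω : TopologicalSpace.Opens (EuclideanSpace ℝ (Fin n))}
    (hΩ : Bornology.IsBounded (Ω : Set (EuclideanSpace ℝ (Fin n)))) (i : Fin n) (z : ℂ)
    (T : ℂ →L[ℝ] ℝ) :
    MemLp (fun x => T (coordExp i z x)) p (volume.restrict (enlarged δ Ω)) := by
  have hb : Bornology.IsBounded (enlarged δ Ω) := hΩ.thickening
  have : IsFiniteMeasure (volume.restrict (enlarged δ Ω)) :=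
    isFiniteMeasure_restrict.2 hb.measure_lt_top.ne
  have hcont : Continuous fun x : EuclideanSpace ℝ (Fin n) => T (coordExp i z x) :=
    T.continuous.comp (continuous_coordExp i z)
  obtain ⟨C, hC⟩ := hb.isCompact_closure.exists_bound_of_continuousOn hcont.continuousOn
  refine MemLp.of_bound hcont.aestronglyMeasurable C ?_
  exact (ae_restrict_iff' isOpen_thickening.measurableSet).2
    (ae_of_all _ fun x hx => hC x (subset_closure hx))

/-- A real part or an imaginary part of an exponential at a zero of the symbol has zero nonlocal
gradient. -/
theorem isWeakNonlocalGradient_clm_coordExp {p : ℝ≥0∞} [Fact (1 ≤ p)] {s : ℝ}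
    (hs : s ∈ Ioo (0 : ℝ) 1) (hδ : 0 < δ) (w : CutOff n δ)
    {Ω : TopologicalSpace.Opens (EuclideanSpace ℝ (Fin n))}
    (hΩ : Bornology.IsBounded (Ω : Set (EuclideanSpace ℝ (Fin n)))) {i : Fin n} {z : ℂ}
    (hz : expSymbol s w i i z = 0) (T : ℂ →L[ℝ] ℝ) :
    IsWeakNonlocalGradient s w Ω ((memLp_clm_coordExp (δ := δ) p hΩ i z T).toLp _)
      (0 : LpVec p Ω) := by
  rw [isWeakNonlocalGradient_iff]
  intro ψ hψ hc hsub
  have h1 : ∫ x in (Ω : Set (EuclideanSpace ℝ (Fin n))), inner ℝ ((0 : LpVec p Ω) x) (ψ x) = 0 := by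
    refine integral_eq_zero_of_ae ?_
    filter_upwards [Lp.coeFn_zero (EuclideanSpace ℝ (Fin n)) p
      (volume.restrict (Ω : Set (EuclideanSpace ℝ (Fin n))))] with x hx
    rw [hx]
    exact inner_zero_left _
  -- The divergence is real-valued, so the real-linear `T` passes through the integral and through
  -- multiplication by it.
  have h2 := T.integral_comp_comm
    (integrable_coordExp_mul_nonlocalDiv hs w hψ hc i z).integrableOn (μ := volume.restrict (enlarged δ Ω))
  rw [setIntegral_coordExp_mul_nonlocalDiv_eq_zero hs hδ w hψ hc hsub hz, map_zero] at h2
  rw [h1, eq_comm, neg_eq_zero, ← h2]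
  refine integral_congr_ae ?_
  filter_upwards [(memLp_clm_coordExp (δ := δ) p hΩ i z T).coeFn_toLp] with x hx
  rw [hx, mul_comm (coordExp i z x), ← Complex.real_smul, map_smul, smul_eq_mul, mul_comm]

/-! ### Closedness and membership in the zero-gradient space -/

variable (s : Ioo (0 : ℝ) 1) (w : CutOff n δ) (p : ℝ≥0∞) [Fact (1 ≤ p)]
  (Ω : TopologicalSpace.Opens (EuclideanSpace ℝ (Fin n)))

theorem mem_zeroGradient_iff (h : HSpace s w p Ω) :
    h ∈ zeroGradient s w p Ω ↔ nonlocalGrad s w p Ω h = 0 :=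
  (Lp.eq_zero_iff_ae_eq_zero).symm

/-- The gradient is the second component of the graph map, whose norm defines that of the space; its
operator norm is at most one. -/
theorem continuous_nonlocalGrad : Continuous (nonlocalGrad s w p Ω) :=
  ((nonlocalGrad s w p Ω).mkContinuous 1 fun u => by
    rw [one_mul]
    exact WithLp.norm_snd_le (p := p) _ (graphMap s w p Ω u)).continuous

theorem isClosed_zeroGradient : IsClosed (zeroGradient s w p Ω : Set (HSpace s w p Ω)) := by
  have : (zeroGradient s w p Ω : Set (HSpace s w p Ω)) = nonlocalGrad s w p Ω ⁻¹' {0} :=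
    Set.ext (mem_zeroGradient_iff s w p Ω)
  rw [this]
  exact isClosed_singleton.preimage (continuous_nonlocalGrad s w p Ω)

variable {s w p Ω}

theorem exists_mem_zeroGradient_clm_coordExp (hδ : 0 < δ)
    (hΩ : Bornology.IsBounded (Ω : Set (EuclideanSpace ℝ (Fin n)))) {i : Fin n} {z : ℂ}
    (hz : expSymbol s w i i z = 0) (T : ℂ →L[ℝ] ℝ) :
    ∃ h : zeroGradient s w p Ω, HSpace.toLp s w p Ω h =ᵐ[volume.restrict (enlarged δ Ω)]
      fun x => T (coordExp i z x) := by
  have hg := isWeakNonlocalGradient_clm_coordExp (p := p) s.2 hδ w hΩ hz T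
  let u : HSpace s w p Ω := ⟨(memLp_clm_coordExp (δ := δ) p hΩ i z T).toLp _, 0, hg⟩
  have hu : nonlocalGrad s w p Ω u = 0 :=
    IsWeakNonlocalGradient.unique (nonlocalGrad_spec s w p Ω u) hg
  exact ⟨⟨u, (mem_zeroGradient_iff s w p Ω u).2 hu⟩,
    (memLp_clm_coordExp (δ := δ) p hΩ i z T).coeFn_toLp⟩

/-! ### Linear independence -/

/-- Dedekind's independence of characters of the additive group `ℝ`. Different exponents give
different characters because the derivative at `0` recovers `z`. -/
theorem linearIndependent_cexp_mul :
    LinearIndependent ℂ fun (z : ℂ) (t : ℝ) => Complex.exp (z * t) := by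
  let χ : ℂ → (Multiplicative ℝ →* ℂ) := fun z =>
    { toFun := fun t => Complex.exp (z * (t.toAdd : ℝ))
      map_one' := by simp
      map_mul' := fun a b => by simp [mul_add, Complex.exp_add] }
  have hχ : Function.Injective χ := by
    intro z z' h
    have hd : ∀ z : ℂ, HasDerivAt (fun t : ℝ => Complex.exp (z * t)) z 0 := fun z => by
      simpa using (((hasDerivAt_id (0 : ℝ)).ofReal_comp).const_mul z).cexp
    have he : (fun t : ℝ => Complex.exp (z * t)) = fun t : ℝ => Complex.exp (z' * t) :=
      funext fun t => DFunLike.congr_fun h (Multiplicative.ofAdd t)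
    exact (hd z).unique (he ▸ hd z')
  exact (linearIndependent_monoidHom (Multiplicative ℝ) ℂ).comp χ hχ

/-- By continuity the relation holds everywhere on `U`. On a line in direction `e_i` through a point
of `U` it is analytic in the parameter, so it persists on all of `ℝ`, where the characters are
independent. -/
theorem eq_zero_of_sum_coordExp_ae_eq_zero {U : Set (EuclideanSpace ℝ (Fin n))} (hU : IsOpen U)
    (hne : U.Nonempty) (i : Fin n) {ι : Type*} {ζ : ι → ℂ}
    (hζ : Function.Injective ζ) (S : Finset ι) (r : ι → ℂ)
    (h : ∀ᵐ x ∂volume.restrict U, ∑ k ∈ S, r k * coordExp i (ζ k) x = 0) : ∀ k ∈ S, r k = 0 := by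
  have hc : Continuous fun x : EuclideanSpace ℝ (Fin n) => ∑ k ∈ S, r k * coordExp i (ζ k) x :=
    continuous_finsetSum _ fun k _ => continuous_const.mul (continuous_coordExp i (ζ k))
  have h0 := Measure.eqOn_open_of_ae_eq (g := fun _ => 0) h hU hc.continuousOn continuousOn_const
  obtain ⟨x₀, hx₀⟩ := hne
  have hline : ∀ t : ℝ, ∀ z, coordExp i z (x₀ + t • EuclideanSpace.single i (1 : ℝ)) =
      coordExp i z x₀ * Complex.exp (z * t) := fun t z => by
    rw [coordExp_add]
    simp [coordExp]
  have hev : ∀ᶠ t : ℝ in 𝓝 0, ∑ k ∈ S, r k * coordExp i (ζ k) x₀ * Complex.exp (ζ k * t) = 0 := by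
    have hcont : ContinuousAt (fun t : ℝ => x₀ + t • EuclideanSpace.single i (1 : ℝ)) 0 := by
      fun_prop
    filter_upwards [hcont.preimage_mem_nhds (by simpa using hU.mem_nhds hx₀)] with t ht
    simpa only [hline, ← mul_assoc] using h0 ht
  have han : AnalyticOnNhd ℝ
      (fun t : ℝ => ∑ k ∈ S, r k * coordExp i (ζ k) x₀ * Complex.exp (ζ k * t)) univ := by
    intro t _
    refine Finset.analyticAt_fun_sum _ fun k _ => analyticAt_const.mul ?_
    have : AnalyticAt ℝ (fun t : ℝ => ζ k * (t : ℂ)) t :=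
      analyticAt_const.mul (Complex.ofRealCLM.analyticAt t)
    exact (analyticAt_cexp.restrictScalars (𝕜 := ℝ)).fun_comp this
  have hall := han.eq_of_eventuallyEq (g := fun _ => 0) analyticOnNhd_const hev
  intro k hk
  have := linearIndependent_iff'.1 (linearIndependent_cexp_mul.comp ζ hζ) S
    (fun k => r k * coordExp i (ζ k) x₀)
    (by
      ext t
      simpa using congrFun hall t) k hk
  exact (mul_eq_zero.1 this).resolve_right (Complex.exp_ne_zero _)

theorem not_finiteDimensional_zeroGradient (hδ : 0 < δ) (i : Fin n)
    (hΩ : Bornology.IsBounded (Ω : Set (EuclideanSpace ℝ (Fin n))))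
    (hne : (Ω : Set (EuclideanSpace ℝ (Fin n))).Nonempty) :
    ¬ FiniteDimensional ℝ (zeroGradient s w p Ω) := by
  intro hfin
  choose a ha using fun z : {z | expSymbol s w i i z = 0} =>
    exists_mem_zeroGradient_clm_coordExp (p := p) hδ hΩ z.2 Complex.reCLM
  choose b hb using fun z : {z | expSymbol s w i i z = 0} =>
    exists_mem_zeroGradient_clm_coordExp (p := p) hδ hΩ z.2 Complex.imCLM
  -- Real parts alone need not be independent, since conjugate zeros share them, and the zero `z =
  -- 0` has vanishing imaginary part. The pairs are independent over `ℝ`: a real relation between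
  -- them is one between the complex exponentials.
  have hli : LinearIndependent ℝ fun z => (a z, b z) := by
    rw [linearIndependent_iff']
    intro S r hS z hz
    let Λ : zeroGradient s w p Ω →ₗ[ℝ] LpEnlarged p δ Ω :=
      HSpace.toLp s w p Ω ∘ₗ (zeroGradient s w p Ω).subtype
    have key : ∀ (T : ℂ →L[ℝ] ℝ) (c : {z | expSymbol s w i i z = 0} → zeroGradient s w p Ω),
        (∀ z, Λ (c z) =ᵐ[volume.restrict (enlarged δ Ω)] fun x => T (coordExp i z x)) →
        ∑ z ∈ S, r z • c z = 0 →
        ∀ᵐ x ∂volume.restrict (enlarged δ Ω), ∑ z ∈ S, r z * T (coordExp i z x) = 0 := by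
      intro T c hcT hc0
      have h0 : ∑ z ∈ S, r z • Λ (c z) = 0 := by
        simpa only [map_sum, map_smul, map_zero] using congrArg Λ hc0
      have h1 := Lp.coeFn_fun_finsetSum S fun z => r z • Λ (c z)
      rw [h0] at h1
      have h2 : ∀ᵐ x ∂volume.restrict (enlarged δ Ω), ∀ z ∈ S,
          (r z • Λ (c z) : LpEnlarged p δ Ω) x = r z * T (coordExp i z x) := by
        rw [Finset.eventually_all]
        intro z _
        filter_upwards [Lp.coeFn_smul (r z) (Λ (c z)), hcT z] with x hx hx'
        rw [hx, Pi.smul_apply, hx', smul_eq_mul]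
      filter_upwards [h1, h2, Lp.coeFn_zero ℝ p (volume.restrict (enlarged δ Ω))] with x e1 e2 e3
      rw [← Finset.sum_congr rfl e2, ← e1, e3, Pi.zero_apply]
    have hre := key Complex.reCLM a ha (by simpa [Prod.fst_sum] using congrArg Prod.fst hS)
    have him := key Complex.imCLM b hb (by simpa [Prod.snd_sum] using congrArg Prod.snd hS)
    have := eq_zero_of_sum_coordExp_ae_eq_zero (U := enlarged δ Ω) isOpen_thickening
      (hne.mono (self_subset_thickening hδ _)) i Subtype.val_injective S (fun z => (r z : ℂ)) (by
        filter_upwards [hre, him] with x h1 h2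
        refine Complex.ext ?_ ?_
        · rw [Complex.re_sum]
          exact (Finset.sum_congr rfl fun z _ => Complex.re_ofReal_mul _ _).trans h1
        · rw [Complex.im_sum]
          exact (Finset.sum_congr rfl fun z _ => Complex.im_ofReal_mul _ _).trans h2) z hz
    exact_mod_cast this
  -- If the zero-gradient space were finite-dimensional, so would be its square, and the independent
  -- family of pairs would be finite.
  exact infinite_zeros_expSymbol s.2 hδ w i (Set.finite_coe_iff.1 hli.finite)

end NonlocalSobolev

end

theorem proposition3p3 {n : ℕ} (hn : 1 ≤ n) (s : Set.Ioo (0 : ℝ) 1) {δ : ℝ} (hδ : 0 < δ)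
    (w : NonlocalSobolev.CutOff n δ) (p : ℝ≥0∞) [Fact (1 ≤ p)]
    (Ω : TopologicalSpace.Opens (EuclideanSpace ℝ (Fin n)))
    (hΩ : NonlocalSobolev.IsBoundedLipschitzDomain (Ω : Set (EuclideanSpace ℝ (Fin n)))) :
    IsClosed (NonlocalSobolev.zeroGradient s w p Ω : Set (NonlocalSobolev.HSpace s w p Ω)) ∧
      ¬ FiniteDimensional ℝ (NonlocalSobolev.zeroGradient s w p Ω) :=
  ⟨NonlocalSobolev.isClosed_zeroGradient s w p Ω,
    NonlocalSobolev.not_finiteDimensional_zeroGradient hδ ⟨0, hn⟩ hΩ.isBounded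
      hΩ.isConnected.nonempty⟩
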